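/- Let $s=(s_n)_{n\ge0}$ be a normalized Stieltjes moment sequence ($s_0=1$) which is indeterminate in the sense of Stieltjes, i.e. there is more than one probability measure supported by $[0,\infty)$ with moment sequence $s$. Let $V$ be the set of all probability measures $\mu$ on $\mathbb R$ having moments of every order with $\int x^n\,d\mu(x)=s_n$ for all $n\ge 0$ (the solutions of the Hamburger problem), and put $\xi(\mu)=\inf\operatorname{supp}(\mu)\in[-\infty,\infty)$ for $\mu\in V$. Let $P_n$ ($\deg P_n=n$, positive leading coefficient) be the orthonormal polynomials of $s$, let $a_n=\int xP_n^2\,d\mu$ and $b_n=\int xP_nP_{n+1}\,d\mu$ ($\mu\in V$), and let $Q_n$ be the polynomials of the second kind, given by $Q_0=0$, $Q_1=1/b_0$ and $xQ_n=b_nQ_{n+1}+a_nQ_n+b_{n-1}Q_{n-1}$ for $n\ge1$. Let $$A(z)=z\sum_{k\ge0}Q_k(z)Q_k(0),\quad B(z)=-1+z\sum_{k\ge0}P_k(z)Q_k(0),$$ $$C(z)=1+z\sum_{k\ge0}Q_k(z)P_k(0),\quad D(z)=z\sum_{k\ge0}P_k(z)P_k(0)$$ be the Nevanlinna functions of $s$.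 Then the limit $\alpha(s)=\lim_{n\to\infty}P_n(0)/Q_n(0)$ exists and is negative; the limit $\xi_1=\lim_{n\to\infty}x_{n,1}$ exists in $\mathbb R$, where $x_{n,1}$ is the smallest zero of $P_n$, $n\ge 1$; and there is exactly one $\nu_{\alpha(s)}\in V$ (the Friedrichs solution) such that $$\int\frac{d\nu_{\alpha(s)}(x)}{x-z}=-\frac{A(z)\alpha(s)-C(z)}{B(z)\alpha(s)-D(z)},\qquad z\in\mathbb C\setminus\mathbb R.$$ Moreover $\xi(\nu_{\alpha(s)})=\xi_1$, and every $\nu\in V$ with $\nu\neq\nu_{\alpha(s)}$ satisfies $$\xi(\nu)<\xi(\nu_{\alpha(s)})=\xi_1 .$$ -/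

import Mathlib

open MeasureTheory Filter Topology Polynomial

noncomputable section

namespace MomentProblem

/-- `μ` is a solution of the (normalized) Hamburger moment problem for `s`: a probability measure
on `ℝ` with moments of every order, equal to those prescribed by `s`. -/
structure IsHamburgerSolution (s : ℕ → ℝ) (μ : Measure ℝ) : Prop where
  isProbabilityMeasure : IsProbabilityMeasure μ
  integrable_pow : ∀ n : ℕ, Integrable (fun x : ℝ => x ^ n) μ
  integral_pow : ∀ n : ℕ, ∫ x, x ^ n ∂μ = s n

/-- A solution of the Stieltjes problem: a Hamburger solution supported by `[0, ∞)`. -/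
def IsStieltjesSolution (s : ℕ → ℝ) (μ : Measure ℝ) : Prop :=
  IsHamburgerSolution s μ ∧ μ.support ⊆ Set.Ici 0

/-- `s` is a normalized Stieltjes moment sequence that is indeterminate in the sense of Stieltjes:
more than one solution is supported by `[0, ∞)`. -/
def IsIndetStieltjes (s : ℕ → ℝ) : Prop :=
  ∃ μ₁ μ₂ : Measure ℝ, IsStieltjesSolution s μ₁ ∧ IsStieltjesSolution s μ₂ ∧ μ₁ ≠ μ₂

/-- The infimum of the support, as an extended real (it may be `-∞`). -/
def infSupport (μ : Measure ℝ) : EReal :=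
  sInf ((fun x : ℝ => (x : EReal)) '' μ.support)

/-- The linear functional on real polynomials with `X ^ n ↦ s n`; it is integration against any
solution of the moment problem. -/
def momentFunctional (s : ℕ → ℝ) : ℝ[X] →ₗ[ℝ] ℝ :=
  Polynomial.lsum fun n => s n • LinearMap.id

/-- The monic orthogonal polynomials of `s` (Gram-Schmidt applied to `1, X, X ^ 2, …`). -/
def monicOrthogonal (s : ℕ → ℝ) (n : ℕ) : ℝ[X] :=
  X ^ n - ∑ k : Fin n,
    C (momentFunctional s (X ^ n * monicOrthogonal s k) /
        momentFunctional s (monicOrthogonal s k * monicOrthogonal s k)) * monicOrthogonal s k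
termination_by n
decreasing_by all_goals exact k.isLt

/-- The orthonormal polynomials `P_n` (degree `n`, positive leading coefficient). -/
def orthP (s : ℕ → ℝ) (n : ℕ) : ℝ[X] :=
  C (1 / √(momentFunctional s (monicOrthogonal s n * monicOrthogonal s n))) * monicOrthogonal s n

/-- The Jacobi parameters `a_n = ∫ x P_n(x)² dμ(x)`. -/
def jacobiA (s : ℕ → ℝ) (n : ℕ) : ℝ := momentFunctional s (X * orthP s n ^ 2)

/-- The Jacobi parameters `b_n = ∫ x P_n(x) P_{n+1}(x) dμ(x)`. -/
def jacobiB (s : ℕ → ℝ) (n : ℕ) : ℝ := momentFunctional s (X * orthP s n * orthP s (n + 1))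

/-- The polynomials of the second kind `Q_n`: `Q_0 = 0`, `Q_1 = 1 / b_0` and
`x Q_n = b_n Q_{n+1} + a_n Q_n + b_{n-1} Q_{n-1}` for `n ≥ 1`. -/
def orthQ (s : ℕ → ℝ) : ℕ → ℝ[X]
  | 0 => 0
  | 1 => C (1 / jacobiB s 0)
  | n + 2 => C (1 / jacobiB s (n + 1)) *
      ((X - C (jacobiA s (n + 1))) * orthQ s (n + 1) - C (jacobiB s n) * orthQ s n)

/-- The two-variable Nevanlinna function `A(u, v)`. -/
def nevA₂ (s : ℕ → ℝ) (u v : ℂ) : ℂ :=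
  (u - v) * ∑' k : ℕ, aeval u (orthQ s k) * aeval v (orthQ s k)

/-- The two-variable Nevanlinna function `B(u, v)`. -/
def nevB₂ (s : ℕ → ℝ) (u v : ℂ) : ℂ :=
  -1 + (u - v) * ∑' k : ℕ, aeval u (orthP s k) * aeval v (orthQ s k)

/-- The two-variable Nevanlinna function `C(u, v)`. -/
def nevC₂ (s : ℕ → ℝ) (u v : ℂ) : ℂ :=
  1 + (u - v) * ∑' k : ℕ, aeval u (orthQ s k) * aeval v (orthP s k)

/-- The two-variable Nevanlinna function `D(u, v)`. -/
def nevD₂ (s : ℕ → ℝ) (u v : ℂ) : ℂ :=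
  (u - v) * ∑' k : ℕ, aeval u (orthP s k) * aeval v (orthP s k)

/-- The Nevanlinna function `A(z) = A(z, 0)`. -/
def nevA (s : ℕ → ℝ) (z : ℂ) : ℂ := nevA₂ s z 0

/-- The Nevanlinna function `B(z) = B(z, 0)`. -/
def nevB (s : ℕ → ℝ) (z : ℂ) : ℂ := nevB₂ s z 0

/-- The Nevanlinna function `C(z) = C(z, 0)`. -/
def nevC (s : ℕ → ℝ) (z : ℂ) : ℂ := nevC₂ s z 0

/-- The Nevanlinna function `D(z) = D(z, 0)`. -/
def nevD (s : ℕ → ℝ) (z : ℂ) : ℂ := nevD₂ s z 0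

/-- `μ` is the N-extremal solution `ν_t`, `t ∈ ℝ`: the Hamburger solution that corresponds to the
constant Pick function `t` in the Nevanlinna parametrization. -/
def IsNExtremal (s : ℕ → ℝ) (t : ℝ) (μ : Measure ℝ) : Prop :=
  IsHamburgerSolution s μ ∧
    ∀ z : ℂ, z.im ≠ 0 →
      ∫ x : ℝ, 1 / ((x : ℂ) - z) ∂μ =
        -((nevA s z * (t : ℂ) - nevC s z) / (nevB s z * (t : ℂ) - nevD s z))

/-- `α = α(s)`, that is, `α = lim P_n(0) / Q_n(0)`. -/
def IsAlpha (s : ℕ → ℝ) (α : ℝ) : Prop :=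
  Tendsto (fun n : ℕ => (orthP s n).eval 0 / (orthQ s n).eval 0) atTop (𝓝 α)

/-- The smallest zero `x_{n,1}` of `P_n`, for `n ≥ 1`. -/
def smallestZero (s : ℕ → ℝ) (n : ℕ) : ℝ := sInf {x : ℝ | (orthP s n).eval x = 0}

/-- `ξ₁ = lim x_{n,1}`, the limit of the smallest zeros of the orthonormal polynomials. -/
def IsXiOne (s : ℕ → ℝ) (ξ₁ : ℝ) : Prop :=
  Tendsto (fun n : ℕ => smallestZero s n) atTop (𝓝 ξ₁)

end MomentProblem

end

open MomentProblem

/-! Solutions on a half-line `[p, ∞)` are governed by the ratios `-Q_n(p) / P_n(p)`. If `p` lies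
below all zeros, these increase, by the Wronskian identity and the alternating signs of `P_n(p)`.
For a solution on `[p, ∞)` and `y < p`, the Stieltjes transform at `y` is bounded below by Gauss
quadrature (`orthP_mul_nonneg`) and above by a quadrature with a node at `p` (`kernel_mul_nonneg`).
If the ratios tend to `∞`, the two bounds meet and at most one solution lives on `[p, ∞)`
(`eq_of_tendsto_ratio_atTop`).

At `p = 0` there are two solutions, so the ratios stay bounded, and `α < 0` is minus the reciprocal
of their limit. At `ξ₁` they diverge: with bounded ratios, moving from `ξ₁` to the nearby zero
`x_{n,1}` could not bring `P_n` to `0` (`tendsto_ratio_atTop`). Hence only one solution lives on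
`[ξ₁, ∞)`. It is a weak limit of Gauss quadratures, whose nodes lie in `[ξ₁, ∞)` and whose
transforms `-Q_n / P_n` converge to the Nevanlinna quotient with parameter `α`
(`exists_isNExtremal`). Every other solution must charge `(-∞, ξ₁)`.

The analytic input is local uniform square-summability of `P_k` and `Q_k`. Bessel's inequality for
`1 / (x - y)`, applied to two solutions with different transforms at `y`, gives it at the point `y`
(`isSquareSummable_of_ne`). Variation of constants and a Gronwall bound spread it over `ℂ`, so that
`pAt_variation` and `qAt_variation` pass to the limit. -/

noncomputable section

namespace MomentProblem

variable {s : ℕ → ℝ}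

open scoped BoundedContinuousFunction

/-! ### Orthonormal polynomials of a positive definite functional -/

/-- `s` is normalized and its moment functional is positive definite. -/
structure IsPosDef (s : ℕ → ℝ) : Prop where
  map_one : momentFunctional s 1 = 1
  pos : ∀ p : ℝ[X], p ≠ 0 → 0 < momentFunctional s (p * p)

theorem momentFunctional_C_mul (a : ℝ) (p : ℝ[X]) :
    momentFunctional s (C a * p) = a * momentFunctional s p := by
  rw [← smul_eq_C_mul, map_smul, smul_eq_mul]

theorem monicOrthogonal_eq (s : ℕ → ℝ) (n : ℕ) :
    monicOrthogonal s n = X ^ n - ∑ k ∈ Finset.range n,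
      C (momentFunctional s (X ^ n * monicOrthogonal s k) /
        momentFunctional s (monicOrthogonal s k * monicOrthogonal s k)) * monicOrthogonal s k := by
  rw [monicOrthogonal, Finset.sum_range]

theorem monicOrthogonal_monic_natDegree (s : ℕ → ℝ) (n : ℕ) :
    (monicOrthogonal s n).Monic ∧ (monicOrthogonal s n).natDegree = n := by
  induction n using Nat.strong_induction_on with
  | _ n ih =>
    have hdeg : (∑ k ∈ Finset.range n,
        C (momentFunctional s (X ^ n * monicOrthogonal s k) /
          momentFunctional s (monicOrthogonal s k * monicOrthogonal s k)) *
            monicOrthogonal s k).degree < (n : WithBot ℕ) := by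
      rw [← mem_degreeLT]
      refine Submodule.sum_mem _ fun k hk => ?_
      rw [← smul_eq_C_mul]
      refine Submodule.smul_mem _ _ ?_
      rw [mem_degreeLT]
      have hk' := Finset.mem_range.1 hk
      calc (monicOrthogonal s k).degree ≤ (monicOrthogonal s k).natDegree := degree_le_natDegree
        _ = (k : WithBot ℕ) := by rw [(ih k hk').2]
        _ < n := by exact_mod_cast hk'
    rw [monicOrthogonal_eq]
    refine ⟨monic_X_pow_sub hdeg, ?_⟩
    refine natDegree_eq_of_degree_eq_some ?_
    rw [degree_sub_eq_left_of_degree_lt (by rwa [degree_X_pow]), degree_X_pow]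

theorem IsPosDef.monicOrthogonal_sq_pos (h : IsPosDef s) (n : ℕ) :
    0 < momentFunctional s (monicOrthogonal s n * monicOrthogonal s n) :=
  h.pos _ (monicOrthogonal_monic_natDegree s n).1.ne_zero

theorem IsPosDef.monicOrthogonal_mul_of_lt (h : IsPosDef s) {n k : ℕ} (hk : k < n) :
    momentFunctional s (monicOrthogonal s n * monicOrthogonal s k) = 0 := by
  induction n using Nat.strong_induction_on generalizing k with
  | _ n ih =>
    have hort : ∀ j < n, j ≠ k →
        momentFunctional s (monicOrthogonal s j * monicOrthogonal s k) = 0 := by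
      intro j hj hjk
      rcases lt_or_gt_of_ne hjk with h1 | h1
      · rw [mul_comm]; exact ih k hk h1
      · exact ih j hj h1
    rw [monicOrthogonal_eq s n, sub_mul, map_sub, Finset.sum_mul, map_sum,
      Finset.sum_eq_single_of_mem k (Finset.mem_range.2 hk)]
    · rw [mul_assoc, momentFunctional_C_mul, div_mul_cancel₀ _ (h.monicOrthogonal_sq_pos k).ne',
        sub_self]
    · intro j hj hjk
      rw [mul_assoc, momentFunctional_C_mul, hort j (Finset.mem_range.1 hj) hjk, mul_zero]

theorem IsPosDef.normalizer_pos (h : IsPosDef s) (n : ℕ) :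
    0 < 1 / √(momentFunctional s (monicOrthogonal s n * monicOrthogonal s n)) :=
  one_div_pos.2 (Real.sqrt_pos.2 (h.monicOrthogonal_sq_pos n))

theorem IsPosDef.orthP_natDegree (h : IsPosDef s) (n : ℕ) : (orthP s n).natDegree = n := by
  rw [orthP, natDegree_C_mul (h.normalizer_pos n).ne', (monicOrthogonal_monic_natDegree s n).2]

theorem IsPosDef.orthP_leadingCoeff_pos (h : IsPosDef s) (n : ℕ) :
    0 < (orthP s n).leadingCoeff := by
  rw [orthP, leadingCoeff_mul, leadingCoeff_C, (monicOrthogonal_monic_natDegree s n).1.leadingCoeff,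
    mul_one]
  exact h.normalizer_pos n

theorem IsPosDef.orthP_ne_zero (h : IsPosDef s) (n : ℕ) : orthP s n ≠ 0 := by
  rw [← leadingCoeff_ne_zero]; exact (h.orthP_leadingCoeff_pos n).ne'

theorem IsPosDef.orthP_degree (h : IsPosDef s) (n : ℕ) : (orthP s n).degree = n := by
  rw [degree_eq_natDegree (h.orthP_ne_zero n), h.orthP_natDegree]

theorem IsPosDef.orthP_mul_orthP (h : IsPosDef s) (n k : ℕ) :
    momentFunctional s (orthP s n * orthP s k) = if n = k then 1 else 0 := by
  have e : orthP s n * orthP s k =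
      C (1 / √(momentFunctional s (monicOrthogonal s n * monicOrthogonal s n))) *
      (C (1 / √(momentFunctional s (monicOrthogonal s k * monicOrthogonal s k))) *
        (monicOrthogonal s n * monicOrthogonal s k)) := by
    simp only [orthP]; ring
  rw [e, momentFunctional_C_mul, momentFunctional_C_mul]
  split_ifs with hnk
  · subst hnk
    have h1 := h.monicOrthogonal_sq_pos n
    have h2 := Real.sqrt_pos.2 h1
    have h3 := Real.sq_sqrt h1.le
    field_simp
    exact h3.symm
  · rcases lt_or_gt_of_ne hnk with h1 | h1
    · rw [mul_comm (monicOrthogonal s n) (monicOrthogonal s k), h.monicOrthogonal_mul_of_lt h1]; simp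
    · rw [h.monicOrthogonal_mul_of_lt h1]; simp

theorem IsPosDef.orthP_zero (h : IsPosDef s) : orthP s 0 = 1 := by
  have : monicOrthogonal s 0 = 1 := by rw [monicOrthogonal_eq]; simp
  rw [orthP, this, mul_one, mul_one, h.map_one]; simp

theorem IsPosDef.exists_expansion (h : IsPosDef s) (n : ℕ) {q : ℝ[X]} (hq : q.degree < n) :
    ∃ c : ℕ → ℝ, q = ∑ k ∈ Finset.range n, C (c k) * orthP s k := by
  induction n generalizing q with
  | zero =>
    refine ⟨0, ?_⟩
    have : q = 0 := by
      rw [← degree_eq_bot]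
      simpa using hq
    simp [this]
  | succ n ih =>
    have hl := (h.orthP_leadingCoeff_pos n).ne'
    have hlc : (orthP s n).coeff n ≠ 0 := by
      rw [leadingCoeff, h.orthP_natDegree] at hl; exact hl
    have hd : (q - C (q.coeff n / (orthP s n).coeff n) * orthP s n).degree < n := by
      rw [degree_lt_iff_coeff_zero]
      intro m hm
      rcases hm.eq_or_lt with rfl | hm
      · rw [coeff_sub, coeff_C_mul, div_mul_cancel₀ _ hlc, sub_self]
      · rw [coeff_sub, coeff_C_mul, (degree_lt_iff_coeff_zero _ _).1 hq m hm,
          coeff_eq_zero_of_natDegree_lt (p := orthP s n) (n := m) (by rw [h.orthP_natDegree]; exact hm)]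
        simp
    obtain ⟨c, hc⟩ := ih hd
    refine ⟨fun k => if k = n then q.coeff n / (orthP s n).coeff n else c k, ?_⟩
    simp only [Finset.sum_range_succ, if_true]
    rw [← sub_eq_iff_eq_add, hc]
    refine Finset.sum_congr rfl fun k hk => ?_
    rw [if_neg (Finset.mem_range.1 hk).ne]

theorem IsPosDef.orthP_mul_of_degree_lt (h : IsPosDef s) {n : ℕ} {q : ℝ[X]} (hq : q.degree < n) :
    momentFunctional s (orthP s n * q) = 0 := by
  obtain ⟨c, rfl⟩ := h.exists_expansion n hq
  rw [Finset.mul_sum, map_sum]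
  refine Finset.sum_eq_zero fun k hk => ?_
  rw [mul_left_comm, momentFunctional_C_mul, h.orthP_mul_orthP,
    if_neg (Finset.mem_range.1 hk).ne', mul_zero]

theorem IsPosDef.expansion (h : IsPosDef s) (n : ℕ) {q : ℝ[X]} (hq : q.degree < n) :
    q = ∑ k ∈ Finset.range n, C (momentFunctional s (q * orthP s k)) * orthP s k := by
  obtain ⟨c, hc⟩ := h.exists_expansion n hq
  have : ∀ k ∈ Finset.range n, momentFunctional s (q * orthP s k) = c k := by
    intro k hk
    rw [hc, Finset.sum_mul, map_sum, Finset.sum_eq_single_of_mem k hk]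
    · rw [mul_assoc, momentFunctional_C_mul, h.orthP_mul_orthP, if_pos rfl, mul_one]
    · intro j _ hjk
      rw [mul_assoc, momentFunctional_C_mul, h.orthP_mul_orthP, if_neg hjk, mul_zero]
  conv_lhs => rw [hc]
  exact Finset.sum_congr rfl fun k hk => by rw [this k hk]

/-- The kernel polynomial `∑_{k<n} P_k(p) P_k` reproduces polynomials of degree `< n`. -/
theorem IsPosDef.kernel_reproducing (h : IsPosDef s) (n : ℕ) (p : ℝ) {q : ℝ[X]}
    (hq : q.degree < n) :
    momentFunctional s ((∑ k ∈ Finset.range n, C ((orthP s k).eval p) * orthP s k) * q) =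
      q.eval p := by
  conv_rhs => rw [h.expansion n hq]
  rw [eval_finsetSum, Finset.sum_mul, map_sum]
  refine Finset.sum_congr rfl fun k _ => ?_
  rw [mul_assoc, momentFunctional_C_mul, eval_mul, eval_C, mul_comm q, mul_comm]

theorem IsPosDef.X_mul_orthP_degree_lt (h : IsPosDef s) (n : ℕ) :
    (X * orthP s n).degree < ((n + 2 : ℕ) : WithBot ℕ) := by
  rw [degree_mul, degree_X, h.orthP_degree]
  norm_cast; omega

theorem IsPosDef.X_mul_orthP_zero (h : IsPosDef s) :
    X * orthP s 0 = C (jacobiB s 0) * orthP s 1 + C (jacobiA s 0) * orthP s 0 := by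
  conv_lhs => rw [h.expansion 2 (h.X_mul_orthP_degree_lt 0)]
  rw [Finset.sum_range_succ, Finset.sum_range_one, add_comm, jacobiA, jacobiB, sq, mul_assoc,
    mul_assoc]

theorem IsPosDef.X_mul_orthP_succ (h : IsPosDef s) (n : ℕ) :
    X * orthP s (n + 1) = C (jacobiB s (n + 1)) * orthP s (n + 2) +
      C (jacobiA s (n + 1)) * orthP s (n + 1) + C (jacobiB s n) * orthP s n := by
  conv_lhs => rw [h.expansion (n + 3) (h.X_mul_orthP_degree_lt (n + 1))]
  rw [Finset.sum_range_succ, Finset.sum_range_succ, Finset.sum_range_succ, Finset.sum_eq_zero,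
    zero_add]
  · have e1 : X * orthP s (n + 1) * orthP s n = X * orthP s n * orthP s (n + 1) := by ring
    have e2 : X * orthP s (n + 1) * orthP s (n + 1) = X * orthP s (n + 1) ^ 2 := by ring
    rw [e1, e2, jacobiA, jacobiB, jacobiB]
    ring
  · intro k hk
    have e : X * orthP s (n + 1) * orthP s k = orthP s (n + 1) * (X * orthP s k) := by ring
    rw [e, h.orthP_mul_of_degree_lt, C_0, zero_mul]
    refine (h.X_mul_orthP_degree_lt k).trans_le ?_
    have := Finset.mem_range.1 hk
    exact_mod_cast (by omega : k + 2 ≤ n + 1)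

/-- Comparing coefficients of `X ^ (n + 1)` in the recurrence makes `b_n` a quotient of two positive
leading coefficients. -/
theorem IsPosDef.jacobiB_pos (h : IsPosDef s) (n : ℕ) : 0 < jacobiB s n := by
  have key : (orthP s n).leadingCoeff = jacobiB s n * (orthP s (n + 1)).leadingCoeff := by
    have hz : ∀ k < n + 1, (orthP s k).coeff (n + 1) = 0 := fun k hk =>
      coeff_eq_zero_of_natDegree_lt (by rw [h.orthP_natDegree]; exact hk)
    rw [leadingCoeff, leadingCoeff, h.orthP_natDegree, h.orthP_natDegree, ← coeff_X_mul]
    cases n with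
    | zero => rw [h.X_mul_orthP_zero]; simp [hz]
    | succ n => rw [h.X_mul_orthP_succ]; simp [hz]
  have h1 := h.orthP_leadingCoeff_pos n
  rw [key] at h1
  exact pos_of_mul_pos_left h1 (h.orthP_leadingCoeff_pos (n + 1)).le

/-! ### Three-term recurrence and variation of constants -/

/-- A solution of a three-term recurrence at `z`, written by variation of constants in terms of
the solutions at `y`. -/
theorem recurrence_variation {K : Type*} [Field K] {a b p q g u : ℕ → K} {y z : K}
    (hb : ∀ n, b n ≠ 0)
    (hp : ∀ n, y * p (n + 1) = b (n + 1) * p (n + 2) + a (n + 1) * p (n + 1) + b n * p n)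
    (hq : ∀ n, y * q (n + 1) = b (n + 1) * q (n + 2) + a (n + 1) * q (n + 1) + b n * q n)
    (hg : ∀ n, y * g (n + 1) = b (n + 1) * g (n + 2) + a (n + 1) * g (n + 1) + b n * g n)
    (hu : ∀ n, z * u (n + 1) = b (n + 1) * u (n + 2) + a (n + 1) * u (n + 1) + b n * u n)
    (hW : ∀ n, b n * (q (n + 1) * p n - q n * p (n + 1)) = 1)
    (h0 : u 0 = g 0) (h1 : u 1 = g 1 + (z - y) * (p 0 * q 1 - q 0 * p 1) * u 0) (n : ℕ) :
    u n = g n + (z - y) * ((∑ k ∈ Finset.range n, p k * u k) * q n -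
      (∑ k ∈ Finset.range n, q k * u k) * p n) := by
  suffices H : ∀ n, (u n = g n + (z - y) * ((∑ k ∈ Finset.range n, p k * u k) * q n -
      (∑ k ∈ Finset.range n, q k * u k) * p n)) ∧
      (u (n + 1) = g (n + 1) + (z - y) * ((∑ k ∈ Finset.range (n + 1), p k * u k) * q (n + 1) -
      (∑ k ∈ Finset.range (n + 1), q k * u k) * p (n + 1))) from (H n).1
  intro n
  induction n with
  | zero => exact ⟨by simp [h0], by simp [h1]; ring⟩
  | succ n ih =>
    obtain ⟨ih1, ih2⟩ := ih
    refine ⟨ih2, mul_left_cancel₀ (hb (n + 1)) ?_⟩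
    rw [Finset.sum_range_succ _ (n + 1), Finset.sum_range_succ _ (n + 1)]
    rw [Finset.sum_range_succ _ n, Finset.sum_range_succ _ n] at ih2 ⊢
    set S := ∑ k ∈ Finset.range n, p k * u k
    set T := ∑ k ∈ Finset.range n, q k * u k
    -- The summand `k = n` contributes nothing at index `n`, so `ih1` needs no correction; the new
    -- summand `k = n + 1` becomes `(z - y) * u (n + 1)` through the Wronskian `hW (n + 1)`.
    linear_combination (-1 : K) * hu n + hg n + (y - a (n + 1)) * ih2 - b n * ih1 +
      (z - y) * (S + p n * u n) * hq n - (z - y) * (T + q n * u n) * hp n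
      - (z - y) * u (n + 1) * hW (n + 1)

section Values

variable {𝕜 : Type*} [RCLike 𝕜]

/-- The value `P_k(z)`. -/
abbrev pAt (s : ℕ → ℝ) (z : 𝕜) (k : ℕ) : 𝕜 := aeval z (orthP s k)

/-- The value `Q_k(z)`. -/
abbrev qAt (s : ℕ → ℝ) (z : 𝕜) (k : ℕ) : 𝕜 := aeval z (orthQ s k)

theorem IsPosDef.pAt_zero (h : IsPosDef s) (z : 𝕜) : pAt s z 0 = 1 := by
  rw [pAt, h.orthP_zero, _root_.map_one]

theorem IsPosDef.pAt_rec_zero (h : IsPosDef s) (z : 𝕜) :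
    z = (jacobiB s 0 : 𝕜) * pAt s z 1 + (jacobiA s 0 : 𝕜) := by
  have := congrArg (aeval z) h.X_mul_orthP_zero
  simpa [h.orthP_zero, RCLike.algebraMap_eq_ofReal] using this

theorem IsPosDef.pAt_rec (h : IsPosDef s) (z : 𝕜) (n : ℕ) :
    z * pAt s z (n + 1) = (jacobiB s (n + 1) : 𝕜) * pAt s z (n + 2) +
      (jacobiA s (n + 1) : 𝕜) * pAt s z (n + 1) + (jacobiB s n : 𝕜) * pAt s z n := by
  have := congrArg (aeval z) (h.X_mul_orthP_succ n)
  simpa [RCLike.algebraMap_eq_ofReal] using this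

theorem qAt_zero (s : ℕ → ℝ) (z : 𝕜) : qAt s z 0 = 0 := by
  rw [qAt, orthQ, map_zero]

theorem IsPosDef.ofReal_jacobiB_ne_zero (h : IsPosDef s) (n : ℕ) : (jacobiB s n : 𝕜) ≠ 0 :=
  RCLike.ofReal_ne_zero.2 (h.jacobiB_pos n).ne'

theorem IsPosDef.jacobiB_mul_qAt_one (h : IsPosDef s) (z : 𝕜) :
    (jacobiB s 0 : 𝕜) * qAt s z 1 = 1 := by
  rw [qAt, orthQ, aeval_C, RCLike.algebraMap_eq_ofReal, ← RCLike.ofReal_mul,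
    mul_one_div_cancel (h.jacobiB_pos 0).ne', RCLike.ofReal_one]

theorem IsPosDef.qAt_rec (h : IsPosDef s) (z : 𝕜) (n : ℕ) :
    z * qAt s z (n + 1) = (jacobiB s (n + 1) : 𝕜) * qAt s z (n + 2) +
      (jacobiA s (n + 1) : 𝕜) * qAt s z (n + 1) + (jacobiB s n : 𝕜) * qAt s z n := by
  have := h.ofReal_jacobiB_ne_zero (𝕜 := 𝕜) (n + 1)
  rw [qAt, qAt, qAt, orthQ]
  simp only [map_mul, map_sub, aeval_C, aeval_X, RCLike.algebraMap_eq_ofReal, RCLike.ofReal_div,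
    RCLike.ofReal_one]
  field_simp
  ring

/-- The recurrence keeps this quantity constant in `n`; at `n = 0` it is `b_0 Q_1 = 1`. -/
theorem IsPosDef.wronskian (h : IsPosDef s) (z : 𝕜) (n : ℕ) :
    (jacobiB s n : 𝕜) * (qAt s z (n + 1) * pAt s z n - qAt s z n * pAt s z (n + 1)) = 1 := by
  induction n with
  | zero =>
    rw [qAt_zero, h.pAt_zero]
    linear_combination h.jacobiB_mul_qAt_one z
  | succ n ih =>
    linear_combination ih - h.qAt_rec z n * pAt s z (n + 1) + h.pAt_rec z n * qAt s z (n + 1)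

/-- At `y = 0` the partial sums converge to those defining the Nevanlinna functions; this formula
and its companion for `Q_n` thus carry the asymptotics at `0` to every `z`. -/
theorem IsPosDef.pAt_variation (h : IsPosDef s) (y z : 𝕜) (n : ℕ) :
    pAt s z n = pAt s y n + (z - y) * ((∑ k ∈ Finset.range n, pAt s y k * pAt s z k) * qAt s y n -
      (∑ k ∈ Finset.range n, qAt s y k * pAt s z k) * pAt s y n) := by
  refine recurrence_variation (a := fun n => (jacobiA s n : 𝕜)) (h.ofReal_jacobiB_ne_zero (𝕜 := 𝕜)) (h.pAt_rec y) (h.qAt_rec y)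
    (h.pAt_rec y) (h.pAt_rec z) (h.wronskian y) ?_ ?_ n
  · rw [h.pAt_zero, h.pAt_zero]
  · rw [h.pAt_zero, h.pAt_zero, qAt_zero]
    refine mul_left_cancel₀ (h.ofReal_jacobiB_ne_zero (𝕜 := 𝕜) 0) ?_
    linear_combination h.pAt_rec_zero y - h.pAt_rec_zero z - (z - y) * h.jacobiB_mul_qAt_one y

theorem IsPosDef.qAt_variation (h : IsPosDef s) (y z : 𝕜) (n : ℕ) :
    qAt s z n = qAt s y n + (z - y) * ((∑ k ∈ Finset.range n, pAt s y k * qAt s z k) * qAt s y n -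
      (∑ k ∈ Finset.range n, qAt s y k * qAt s z k) * pAt s y n) := by
  refine recurrence_variation (a := fun n => (jacobiA s n : 𝕜)) (h.ofReal_jacobiB_ne_zero (𝕜 := 𝕜)) (h.pAt_rec y) (h.qAt_rec y)
    (h.qAt_rec y) (h.qAt_rec z) (h.wronskian y) ?_ ?_ n
  · rw [qAt_zero, qAt_zero]
  · refine mul_left_cancel₀ (h.ofReal_jacobiB_ne_zero (𝕜 := 𝕜) 0) ?_
    rw [qAt_zero s z]
    linear_combination h.jacobiB_mul_qAt_one z - h.jacobiB_mul_qAt_one y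

/-- The truncated Nevanlinna matrix has determinant one. -/
theorem IsPosDef.truncated_det (h : IsPosDef s) (y z : 𝕜) (n : ℕ) :
    (1 - (z - y) * ∑ k ∈ Finset.range (n + 1), qAt s y k * pAt s z k) *
      (1 + (z - y) * ∑ k ∈ Finset.range (n + 1), pAt s y k * qAt s z k) +
    ((z - y) * ∑ k ∈ Finset.range (n + 1), qAt s y k * qAt s z k) *
      ((z - y) * ∑ k ∈ Finset.range (n + 1), pAt s y k * pAt s z k) = 1 := by
  have p0 := h.pAt_variation y z n
  have p1 := h.pAt_variation y z (n + 1)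
  have q0 := h.qAt_variation y z n
  have q1 := h.qAt_variation y z (n + 1)
  have wz := h.wronskian z n
  have wy := h.wronskian y n
  have e1 := Finset.sum_range_succ (fun k => pAt s y k * pAt s z k) n
  have e2 := Finset.sum_range_succ (fun k => qAt s y k * pAt s z k) n
  have e3 := Finset.sum_range_succ (fun k => pAt s y k * qAt s z k) n
  have e4 := Finset.sum_range_succ (fun k => qAt s y k * qAt s z k) n
  set Spp := ∑ k ∈ Finset.range (n + 1), pAt s y k * pAt s z k
  set Sqp := ∑ k ∈ Finset.range (n + 1), qAt s y k * pAt s z k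
  set Spq := ∑ k ∈ Finset.range (n + 1), pAt s y k * qAt s z k
  set Sqq := ∑ k ∈ Finset.range (n + 1), qAt s y k * qAt s z k
  -- The summand `k = n` cancels at index `n`, so the same four sums serve at `n` and at `n + 1`.
  have p0' : pAt s z n = pAt s y n + (z - y) * (Spp * qAt s y n - Sqp * pAt s y n) := by
    rw [e1, e2]; linear_combination p0
  have q0' : qAt s z n = qAt s y n + (z - y) * (Spq * qAt s y n - Sqq * pAt s y n) := by
    rw [e3, e4]; linear_combination q0
  clear p0 q0 e1 e2 e3 e4
  -- The Wronskian at `z` is the Wronskian at `y` times the determinant of the transfer matrix.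
  rw [p0', p1, q0', q1] at wz
  linear_combination wz - ((1 - (z - y) * Sqp) * (1 + (z - y) * Spq) +
    ((z - y) * Sqq) * ((z - y) * Spp)) * wy

end Values

/-! ### Local uniform square-summability -/

/-- A discrete Gronwall inequality. -/
theorem le_mul_exp_of_discrete_gronwall {e v : ℕ → ℝ} {R : ℝ} (hR : 0 ≤ R) (he : ∀ k, 0 ≤ e k)
    (hsum : Summable fun k => e k ^ 2)
    (h : ∀ n, v n ≤ e n * (1 + R * ∑ k ∈ Finset.range n, e k * v k)) (n : ℕ) :
    v n ≤ e n * Real.exp (R * ∑' k, e k ^ 2) := by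
  -- Each step multiplies the bracket by at most `1 + R * e n ^ 2`, hence by at most the exponential
  -- of `R * e n ^ 2`.
  have key : ∀ n, 1 + R * ∑ k ∈ Finset.range n, e k * v k ≤
      Real.exp (R * ∑ k ∈ Finset.range n, e k ^ 2) := by
    intro n
    induction n with
    | zero => simp
    | succ n ih =>
      rw [Finset.sum_range_succ, Finset.sum_range_succ, mul_add, mul_add, Real.exp_add]
      have h1 : R * (e n * v n) ≤ R * e n ^ 2 * (1 + R * ∑ k ∈ Finset.range n, e k * v k) := by
        have := mul_le_mul_of_nonneg_left (h n) (mul_nonneg hR (he n))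
        linarith
      have h2 : 1 + R * e n ^ 2 ≤ Real.exp (R * e n ^ 2) := by
        linarith [Real.add_one_le_exp (R * e n ^ 2)]
      have h3 : 0 ≤ 1 + R * e n ^ 2 := by positivity
      calc 1 + (R * ∑ k ∈ Finset.range n, e k * v k + R * (e n * v n))
          ≤ (1 + R * ∑ k ∈ Finset.range n, e k * v k) * (1 + R * e n ^ 2) := by linarith
        _ ≤ Real.exp (R * ∑ k ∈ Finset.range n, e k ^ 2) * Real.exp (R * e n ^ 2) :=
          mul_le_mul ih h2 h3 (Real.exp_pos _).le
  refine (h n).trans (mul_le_mul_of_nonneg_left ((key n).trans (Real.exp_le_exp.2 ?_)) (he n))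
  exact mul_le_mul_of_nonneg_left (hsum.sum_le_tsum _ fun k _ => sq_nonneg _) hR

/-- The orthogonal polynomials of both kinds are dominated, locally uniformly on `ℂ`, by a
square-summable sequence. -/
def IsSquareSummable (s : ℕ → ℝ) : Prop :=
  ∃ e : ℕ → ℝ, (∀ k, 0 ≤ e k) ∧ (Summable fun k => e k ^ 2) ∧
    ∀ R : ℝ, ∃ M : ℝ, 0 ≤ M ∧ ∀ z : ℂ, ‖z‖ ≤ R → ∀ k, ‖pAt s z k‖ ≤ M * e k ∧ ‖qAt s z k‖ ≤ M * e k

/-- Taking `e k = ‖P_k(y)‖ + ‖Q_k(y)‖` dominates both the inhomogeneity and the coefficients in the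
variation formula, so Gronwall transfers the bound from `y` to any disc. -/
theorem IsPosDef.isSquareSummable (h : IsPosDef s) (y : ℂ)
    (hp : Summable fun k => ‖pAt s y k‖ ^ 2) (hq : Summable fun k => ‖qAt s y k‖ ^ 2) :
    IsSquareSummable s := by
  set e : ℕ → ℝ := fun k => ‖pAt s y k‖ + ‖qAt s y k‖ with he
  have he0 : ∀ k, 0 ≤ e k := fun k => by positivity
  have hes : Summable fun k => e k ^ 2 := by
    refine Summable.of_nonneg_of_le (fun k => sq_nonneg _) (fun k => ?_)
      ((hp.add hq).mul_left 2)
    simp only [he]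
    nlinarith [sq_nonneg (‖pAt s y k‖ - ‖qAt s y k‖)]
  have gen : ∀ (z : ℂ) (g u : ℕ → ℂ), (∀ n, ‖g n‖ ≤ e n) →
      (∀ n, u n = g n + (z - y) * ((∑ k ∈ Finset.range n, pAt s y k * u k) * qAt s y n -
        (∑ k ∈ Finset.range n, qAt s y k * u k) * pAt s y n)) →
      ∀ n, ‖u n‖ ≤ e n * Real.exp (‖z - y‖ * ∑' k, e k ^ 2) := by
    intro z g u hg hu n
    refine le_mul_exp_of_discrete_gronwall (v := fun n => ‖u n‖) (norm_nonneg _) he0 hes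
      (fun n => ?_) n
    have h1 : ‖∑ k ∈ Finset.range n, pAt s y k * u k‖ ≤ ∑ k ∈ Finset.range n, e k * ‖u k‖ := by
      refine norm_sum_le_of_le _ fun k _ => ?_
      rw [norm_mul]
      exact mul_le_mul_of_nonneg_right (le_add_of_nonneg_right (norm_nonneg _)) (norm_nonneg _)
    have h2 : ‖∑ k ∈ Finset.range n, qAt s y k * u k‖ ≤ ∑ k ∈ Finset.range n, e k * ‖u k‖ := by
      refine norm_sum_le_of_le _ fun k _ => ?_
      rw [norm_mul]
      exact mul_le_mul_of_nonneg_right (le_add_of_nonneg_left (norm_nonneg _)) (norm_nonneg _)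
    calc ‖u n‖ ≤ ‖g n‖ + ‖z - y‖ * (‖∑ k ∈ Finset.range n, pAt s y k * u k‖ * ‖qAt s y n‖ +
        ‖∑ k ∈ Finset.range n, qAt s y k * u k‖ * ‖pAt s y n‖) := by
          conv_lhs => rw [hu n]
          refine (norm_add_le _ _).trans (add_le_add le_rfl ?_)
          rw [norm_mul, ← norm_mul (∑ k ∈ Finset.range n, pAt s y k * u k),
            ← norm_mul (∑ k ∈ Finset.range n, qAt s y k * u k)]
          exact mul_le_mul_of_nonneg_left (norm_sub_le _ _) (norm_nonneg _)
      _ ≤ e n + ‖z - y‖ * ((∑ k ∈ Finset.range n, e k * ‖u k‖) * ‖qAt s y n‖ +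
        (∑ k ∈ Finset.range n, e k * ‖u k‖) * ‖pAt s y n‖) := by
          gcongr
          exact hg n
      _ = e n * (1 + ‖z - y‖ * ∑ k ∈ Finset.range n, e k * ‖u k‖) := by
          simp only [he]; ring
  refine ⟨e, he0, hes, fun R => ⟨Real.exp ((R + ‖y‖) * ∑' k, e k ^ 2), (Real.exp_pos _).le,
    fun z hz k => ?_⟩⟩
  have hle : Real.exp (‖z - y‖ * ∑' k, e k ^ 2) ≤ Real.exp ((R + ‖y‖) * ∑' k, e k ^ 2) := by
    refine Real.exp_le_exp.2 (mul_le_mul_of_nonneg_right ?_ (tsum_nonneg fun k => sq_nonneg _))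
    exact (norm_sub_le _ _).trans (add_le_add hz le_rfl)
  constructor
  · rw [mul_comm]
    exact (gen z (pAt s y) _ (fun n => le_add_of_nonneg_right (norm_nonneg (qAt s y n)))
      (h.pAt_variation y z) k).trans (mul_le_mul_of_nonneg_left hle (he0 k))
  · rw [mul_comm]
    exact (gen z (qAt s y) _ (fun n => le_add_of_nonneg_left (norm_nonneg (pAt s y n)))
      (h.qAt_variation y z) k).trans (mul_le_mul_of_nonneg_left hle (he0 k))

/-! ### Measures determined by their resolvent integrals -/

section Uniqueness

variable {E : Type*} [TopologicalSpace E]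

/-- The resolvent function `x ↦ 1 / (g x - z)` as a bounded continuous function. -/
def resolventBCF (g : E → ℝ) (hg : Continuous g) (z : ℂ) {δ : ℝ} (hδ : 0 < δ)
    (h : ∀ x, δ ≤ ‖(g x : ℂ) - z‖) : E →ᵇ ℂ :=
  BoundedContinuousFunction.ofNormedAddCommGroup (fun x => 1 / ((g x : ℂ) - z))
    (continuous_const.div (by fun_prop) fun x => norm_pos_iff.1 (hδ.trans_le (h x))) (1 / δ)
    (fun x => by
      rw [norm_div, norm_one]
      exact one_div_le_one_div_of_le hδ (h x))

/-- Integration against a probability measure, as a continuous functional on bounded continuous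
functions. -/
def integralBCF [MeasurableSpace E] [BorelSpace E] (μ : Measure E)
    [IsProbabilityMeasure μ] : (E →ᵇ ℂ) →L[ℂ] ℂ :=
  LinearMap.mkContinuous
    { toFun := fun f => ∫ x, f x ∂μ
      map_add' := fun f g => integral_add (f.integrable μ) (g.integrable μ)
      map_smul' := fun c f => integral_const_mul c _ } 1
    (fun f => by
      rw [one_mul]
      exact (norm_integral_le_of_norm_le_const (Eventually.of_forall f.norm_coe_le_norm)).trans
        (by simp))

variable [PolishSpace E] [MeasurableSpace E] [BorelSpace E]

/-- A probability measure is determined by the integrals of the functions `1 / (g - z)`, `z ∈ Z`,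
where `g` is continuous and injective. -/
theorem ext_of_forall_integral_resolvent_eq {μ ν : Measure E} [IsProbabilityMeasure μ]
    [IsProbabilityMeasure ν] {g : E → ℝ} (hg : Continuous g) (hinj : Function.Injective g)
    {Z : Set ℂ} (hne : Z.Nonempty) (hconj : ∀ z ∈ Z, star z ∈ Z)
    (hshift : ∀ z ∈ Z, ∀ t : ℝ, 0 < t → z - t ∈ Z)
    (hdist : ∀ z ∈ Z, ∃ δ > 0, ∀ x, δ ≤ ‖(g x : ℂ) - z‖)
    (heq : ∀ z ∈ Z, ∫ x, 1 / ((g x : ℂ) - z) ∂μ = ∫ x, 1 / ((g x : ℂ) - z) ∂ν) : μ = ν := by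
  choose! δ hδ hδx using hdist
  have hne0 : ∀ z ∈ Z, ∀ x, (g x : ℂ) - z ≠ 0 := fun z hz x =>
    norm_pos_iff.1 ((hδ z hz).trans_le (hδx z hz x))
  let r : Z → E →ᵇ ℂ := fun z => resolventBCF g hg z (hδ z z.2) (hδx z z.2)
  have hr : ∀ z x, r z x = 1 / ((g x : ℂ) - z) := fun z x => rfl
  -- The integrals agree on the closure `S` of this span. It is stable under multiplication by
  -- resolvents: the resolvent identity handles distinct points, a limit handles squares. So `S`
  -- contains the star algebra they generate, which separates points.
  set S₀ : Submodule ℂ (E →ᵇ ℂ) := Submodule.span ℂ (insert 1 (Set.range r)) with hS₀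
  set S := S₀.topologicalClosure with hS
  have hrS₀ : ∀ z, r z ∈ S₀ := fun z => Submodule.subset_span (Or.inr ⟨z, rfl⟩)
  have hmul_ne : ∀ z w, z ≠ w → r z * r w ∈ S₀ := by
    intro z w hzw
    have hzw' : (z : ℂ) - w ≠ 0 := sub_ne_zero.2 fun h => hzw (Subtype.ext h)
    have : r z * r w = (1 / ((z : ℂ) - w)) • (r z - r w) := by
      ext x
      have h1 := hne0 z z.2 x
      have h2 := hne0 w w.2 x
      simp only [BoundedContinuousFunction.coe_mul, Pi.mul_apply,
        BoundedContinuousFunction.coe_smul, BoundedContinuousFunction.coe_sub, Pi.sub_apply, hr,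
        smul_eq_mul]
      field_simp
      ring
    rw [this]
    exact S₀.smul_mem _ (S₀.sub_mem (hrS₀ z) (hrS₀ w))
  have hsq : ∀ z, r z * r z ∈ S := by
    intro z
    -- Shifting to the left stays inside `Z` both for nonreal points and for points of `(-∞, p)`.
    let u : ℕ → Z := fun n => ⟨(z : ℂ) - ((1 / ((n : ℝ) + 1) : ℝ) : ℂ),
      hshift z z.2 _ (by positivity)⟩
    have hu0 : Tendsto (fun n : ℕ => 1 / ((n : ℝ) + 1)) atTop (𝓝 0) :=
      tendsto_one_div_add_atTop_nhds_zero_nat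
    have hunorm : ∀ n, ‖(z : ℂ) - u n‖ = 1 / ((n : ℝ) + 1) := by
      intro n
      simp only [u, sub_sub_cancel]
      rw [Complex.norm_real, Real.norm_of_nonneg (by positivity)]
    have hd := hδ z z.2
    have hlim : Tendsto (fun n => r (u n)) atTop (𝓝 (r z)) := by
      rw [tendsto_iff_norm_sub_tendsto_zero]
      have hb : Tendsto (fun n : ℕ => 1 / ((n : ℝ) + 1) * (2 / (δ z * δ z))) atTop (𝓝 0) := by
        simpa using hu0.mul_const (2 / (δ z * δ z))
      refine squeeze_zero' (Eventually.of_forall fun n => norm_nonneg _) ?_ hb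
      filter_upwards [hu0.eventually (gt_mem_nhds (half_pos hd))] with n hn
      refine (BoundedContinuousFunction.norm_le (by positivity)).2 fun x => ?_
      have h1 := hne0 z z.2 x
      have h2 := hne0 (u n) (u n).2 x
      have h3 := hδx z z.2 x
      have h4 : δ z / 2 ≤ ‖(g x : ℂ) - u n‖ := by
        have : ‖(g x : ℂ) - z‖ ≤ ‖(g x : ℂ) - u n‖ + ‖(z : ℂ) - u n‖ := by
          have := norm_sub_le ((g x : ℂ) - u n) ((z : ℂ) - u n)
          rwa [sub_sub_sub_cancel_right] at this
        rw [hunorm] at this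
        linarith
      have e : (r (u n) - r z) x = -((z : ℂ) - u n) / (((g x : ℂ) - u n) * ((g x : ℂ) - z)) := by
        simp only [BoundedContinuousFunction.coe_sub, Pi.sub_apply, hr]
        field_simp
        ring
      rw [e, norm_div, norm_neg, hunorm, norm_mul, div_eq_mul_inv]
      refine mul_le_mul_of_nonneg_left ?_ (by positivity)
      rw [inv_eq_one_div, div_le_div_iff₀ (by positivity) (by positivity)]
      nlinarith [mul_le_mul h4 h3 hd.le (norm_nonneg _)]
    have hclosed : IsClosed (S : Set (E →ᵇ ℂ)) := S₀.isClosed_topologicalClosure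
    refine hclosed.mem_of_tendsto (hlim.const_mul (r z)) (Eventually.of_forall fun n => ?_)
    refine S₀.le_topologicalClosure (hmul_ne z (u n) fun h => ?_)
    have := hunorm n
    rw [← h, sub_self, norm_zero] at this
    have : (0 : ℝ) < 1 / ((n : ℝ) + 1) := by positivity
    linarith
  have hmulS : ∀ z, ∀ f ∈ S, r z * f ∈ S := by
    intro z
    have hle : S ≤ S.comap (LinearMap.mulLeft ℂ (r z)) := by
      refine S₀.topologicalClosure_minimal (Submodule.span_le.2 ?_) ?_
      · rintro _ (rfl | ⟨w, rfl⟩)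
        · simpa using S₀.le_topologicalClosure (hrS₀ z)
        · by_cases hzw : z = w
          · subst hzw; simpa using hsq z
          · simpa using S₀.le_topologicalClosure (hmul_ne z w hzw)
      · exact S₀.isClosed_topologicalClosure.preimage
          (continuous_const.mul continuous_id : Continuous fun f => r z * f)
    exact fun f hf => hle hf
  have hSeq : ∀ f ∈ S, ∫ x, f x ∂μ = ∫ x, f x ∂ν := by
    have hle : S ≤ LinearMap.eqLocus (integralBCF μ).toLinearMap (integralBCF ν).toLinearMap := by
      refine S₀.topologicalClosure_minimal (Submodule.span_le.2 ?_) ?_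
      · rintro _ (rfl | ⟨w, rfl⟩)
        · show ∫ x, (1 : E →ᵇ ℂ) x ∂μ = ∫ x, (1 : E →ᵇ ℂ) x ∂ν
          simp
        · exact heq w w.2
      · exact isClosed_eq (integralBCF μ).continuous (integralBCF ν).continuous
    exact fun f hf => hle hf
  have hstar : Set.range r ∪ star (Set.range r) = Set.range r := by
    refine Set.union_eq_left.2 fun f hf => ?_
    obtain ⟨z, hz⟩ := Set.mem_star.1 hf
    refine ⟨⟨star (z : ℂ), hconj z z.2⟩, ?_⟩
    have : f = star (r z) := by rw [hz, star_star]
    rw [this]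
    ext x
    rw [hr, BoundedContinuousFunction.star_apply, hr]
    simp
  have hAS : ∀ f ∈ StarAlgebra.adjoin ℂ (Set.range r), f ∈ S := by
    intro f hf
    rw [← StarSubalgebra.mem_toSubalgebra, StarAlgebra.adjoin_toSubalgebra, hstar,
      ← Subalgebra.mem_toSubmodule, Algebra.adjoin_eq_span] at hf
    refine Submodule.span_le.2 ?_ hf
    intro f hf
    induction hf using Submonoid.closure_induction_left with
    | one => exact S₀.le_topologicalClosure (Submodule.subset_span (Or.inl rfl))
    | mul_left x hx y hy ih =>
      obtain ⟨z, rfl⟩ := hx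
      exact hmulS z _ ih
  refine ext_of_forall_mem_subalgebra_integral_eq_of_polish (𝕜 := ℂ)
    (A := StarAlgebra.adjoin ℂ (Set.range r)) ?_ fun f hf => hSeq f (hAS f hf)
  obtain ⟨z, hz⟩ := hne
  intro x y hxy
  refine ⟨r ⟨z, hz⟩, ⟨_, ⟨r ⟨z, hz⟩, StarAlgebra.subset_adjoin _ _ ⟨_, rfl⟩, rfl⟩, rfl⟩, ?_⟩
  rw [hr, hr]
  intro h
  have h1 := hne0 z hz x
  have h2 := hne0 z hz y
  field_simp at h
  exact hxy (hinj (by simpa using h.symm))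

end Uniqueness

/-- A probability measure on the line is determined by its Stieltjes transform. -/
theorem ext_of_stieltjes_eq {μ ν : Measure ℝ} [IsProbabilityMeasure μ] [IsProbabilityMeasure ν]
    (h : ∀ z : ℂ, z.im ≠ 0 → ∫ x : ℝ, 1 / ((x : ℂ) - z) ∂μ = ∫ x : ℝ, 1 / ((x : ℂ) - z) ∂ν) :
    μ = ν := by
  refine ext_of_forall_integral_resolvent_eq (g := id) continuous_id Function.injective_id
    (Z := {z | z.im ≠ 0}) ⟨Complex.I, by simp⟩ (fun z hz => by simpa using hz)
    (fun z hz t _ => by simpa using hz) (fun z hz => ⟨|z.im|, abs_pos.2 hz, fun x => ?_⟩) h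
  simpa using Complex.abs_im_le_norm ((x : ℂ) - z)

/-- A probability measure on `[p, ∞)` is determined by its Stieltjes transform on `(-∞, p)`. -/
theorem ext_of_stieltjes_eq_of_lt {μ ν : Measure ℝ} [IsProbabilityMeasure μ]
    [IsProbabilityMeasure ν] {p : ℝ} (hμ : ∀ᵐ x ∂μ, p ≤ x) (hν : ∀ᵐ x ∂ν, p ≤ x)
    (h : ∀ y < p, ∫ x, 1 / (x - y) ∂μ = ∫ x, 1 / (x - y) ∂ν) : μ = ν := by
  -- Resolvents at real `y < p` are bounded only on `[p, ∞)`, so both measures are moved to that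
  -- subspace and back.
  have hmap : ∀ m : Measure ℝ, (∀ᵐ x ∂m, p ≤ x) →
      (m.comap ((↑) : Set.Ici p → ℝ)).map ((↑) : Set.Ici p → ℝ) = m := by
    intro m hm
    rw [(MeasurableEmbedding.subtype_coe measurableSet_Ici).map_comap, Subtype.range_coe]
    exact Measure.restrict_eq_self_of_ae_mem hm
  have hprob : ∀ m : Measure ℝ, IsProbabilityMeasure m → (∀ᵐ x ∂m, p ≤ x) →
      IsProbabilityMeasure (m.comap ((↑) : Set.Ici p → ℝ)) := by
    intro m hm1 hm
    constructor
    have := hm1.measure_univ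
    rw [← hmap m hm, (MeasurableEmbedding.subtype_coe measurableSet_Ici).map_apply] at this
    simpa using this
  have hint : ∀ m : Measure ℝ, (∀ᵐ x ∂m, p ≤ x) → ∀ y : ℝ,
      ∫ x : Set.Ici p, 1 / (((x : ℝ) : ℂ) - (y : ℂ)) ∂(m.comap ((↑) : Set.Ici p → ℝ)) =
        ((∫ x, 1 / (x - y) ∂m : ℝ) : ℂ) := by
    intro m hm y
    rw [← integral_complex_ofReal]
    conv_rhs => rw [← hmap m hm]
    rw [(MeasurableEmbedding.subtype_coe measurableSet_Ici).integral_map]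
    refine integral_congr_ae (Eventually.of_forall fun x => ?_)
    push_cast
    rfl
  have := hprob μ ‹_› hμ
  have := hprob ν ‹_› hν
  have : PolishSpace (Set.Ici p) := isClosed_Ici.polishSpace
  rw [← hmap μ hμ, ← hmap ν hν]
  congr 1
  refine ext_of_forall_integral_resolvent_eq (g := ((↑) : Set.Ici p → ℝ)) continuous_subtype_val
    Subtype.val_injective (Z := (fun y : ℝ => (y : ℂ)) '' Set.Iio p) ⟨_, p - 1, by simp, rfl⟩
    ?_ ?_ ?_ ?_
  · rintro _ ⟨y, hy, rfl⟩
    exact ⟨y, hy, by simp⟩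
  · rintro _ ⟨y, hy, rfl⟩ t ht
    refine ⟨y - t, ?_, by simp⟩
    simp only [Set.mem_Iio] at hy ⊢
    linarith
  · rintro _ ⟨y, hy, rfl⟩
    refine ⟨p - y, sub_pos.2 hy, fun x => ?_⟩
    have hx : p ≤ (x : ℝ) := x.2
    rw [← Complex.ofReal_sub, Complex.norm_real]
    exact (sub_le_sub_right hx y).trans (le_abs_self _)
  · rintro _ ⟨y, hy, rfl⟩
    rw [hint μ hμ, hint ν hν, h y hy]

/-! ### Solutions and the moment functional -/

theorem momentFunctional_X_pow (s : ℕ → ℝ) (n : ℕ) : momentFunctional s (X ^ n) = s n := by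
  rw [momentFunctional, lsum_apply, ← monomial_one_right_eq_X_pow, sum_monomial_index] <;> simp

namespace IsHamburgerSolution

variable {μ ν : Measure ℝ}

theorem integrable_eval_and_integral (h : IsHamburgerSolution s μ) (p : ℝ[X]) :
    Integrable (fun x => p.eval x) μ ∧ ∫ x, p.eval x ∂μ = momentFunctional s p := by
  induction p using Polynomial.induction_on' with
  | add p q hp hq =>
    simp only [eval_add, map_add]
    exact ⟨hp.1.add hq.1, by rw [integral_add hp.1 hq.1, hp.2, hq.2]⟩
  | monomial n a =>
    simp only [eval_monomial]
    refine ⟨(h.integrable_pow n).const_mul a, ?_⟩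
    rw [integral_const_mul, h.integral_pow, ← C_mul_X_pow_eq_monomial, momentFunctional_C_mul,
      momentFunctional_X_pow]

theorem integrable_eval (h : IsHamburgerSolution s μ) (p : ℝ[X]) :
    Integrable (fun x => p.eval x) μ := (h.integrable_eval_and_integral p).1

theorem integral_eval (h : IsHamburgerSolution s μ) (p : ℝ[X]) :
    ∫ x, p.eval x ∂μ = momentFunctional s p := (h.integrable_eval_and_integral p).2

/-- Two solutions that both live on the zeros of a nonzero polynomial coincide. -/
theorem eq_of_momentFunctional_sq_eq_zero (hμ : IsHamburgerSolution s μ)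
    (hν : IsHamburgerSolution s ν) {p : ℝ[X]} (hp : p ≠ 0)
    (h0 : momentFunctional s (p * p) = 0) : μ = ν := by
  have := hμ.isProbabilityMeasure
  have := hν.isProbabilityMeasure
  have hae : ∀ m, IsHamburgerSolution s m → ∀ᵐ x ∂m, x ∈ p.roots.toFinset := by
    intro m hm
    have h1 := hm.integral_eval (p * p)
    rw [h0, integral_eq_zero_iff_of_nonneg_ae (Eventually.of_forall fun x => by
      simp only [eval_mul, Pi.zero_apply]; exact mul_self_nonneg _) (hm.integrable_eval _)] at h1
    filter_upwards [h1] with x hx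
    rw [Multiset.mem_toFinset, mem_roots hp]
    simpa using hx
  refine ext_of_forall_integral_eq_of_IsFiniteMeasure fun f => ?_
  -- On the finitely many zeros of `p`, `f` agrees with its Lagrange interpolant, whose integral is
  -- fixed by the moments.
  have hint : ∀ m, IsHamburgerSolution s m → ∫ x, f x ∂m =
      momentFunctional s (Lagrange.interpolate p.roots.toFinset id f) := by
    intro m hm
    rw [← hm.integral_eval]
    refine integral_congr_ae ?_
    filter_upwards [hae m hm] with x hx
    exact (Lagrange.eval_interpolate_at_node (v := id) f Function.injective_id.injOn hx).symm
  rw [hint μ hμ, hint ν hν]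

/-- A degenerate functional forces every solution onto one finite set, where the moments determine
it; non-uniqueness therefore implies definiteness. -/
theorem isPosDef_of_ne (hμ : IsHamburgerSolution s μ) (hν : IsHamburgerSolution s ν)
    (hne : μ ≠ ν) : IsPosDef s where
  map_one := by
    have := hμ.isProbabilityMeasure
    simpa using (hμ.integral_eval 1).symm
  pos := by
    intro p hp
    refine lt_of_le_of_ne ?_ fun h0 => hne (hμ.eq_of_momentFunctional_sq_eq_zero hν hp h0.symm)
    rw [← hμ.integral_eval]
    refine integral_nonneg fun x => ?_
    simp only [eval_mul, Pi.zero_apply]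
    exact mul_self_nonneg _

end IsHamburgerSolution

theorem ae_le_iff_support_subset {μ : Measure ℝ} {p : ℝ} :
    (∀ᵐ x ∂μ, p ≤ x) ↔ μ.support ⊆ Set.Ici p := by
  refine ⟨fun h => Measure.support_subset_of_isClosed isClosed_Ici h, fun h => ?_⟩
  filter_upwards [Measure.support_mem_ae (μ := μ)] with x hx using h hx

theorem coe_le_infSupport_iff {μ : Measure ℝ} {p : ℝ} :
    (p : EReal) ≤ infSupport μ ↔ ∀ᵐ x ∂μ, p ≤ x := by
  rw [ae_le_iff_support_subset, infSupport, le_sInf_iff]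
  simp [Set.subset_def]

/-! ### Zeros of the orthogonal polynomials -/

/-- Zeros are located by testing `P_n = m * q` against `q`: orthogonality gives `0`, while `m * q *
q` has a sign whenever `m` has one. -/
theorem IsPosDef.degree_cofactor_lt (h : IsPosDef s) {n : ℕ} {m q : ℝ[X]} (hm : 1 ≤ m.natDegree)
    (e : orthP s n = m * q) : q ≠ 0 ∧ q.degree < n := by
  have hne := h.orthP_ne_zero n
  rw [e] at hne
  have hq := right_ne_zero_of_mul hne
  refine ⟨hq, ?_⟩
  have hd := h.orthP_natDegree n
  rw [e, natDegree_mul (left_ne_zero_of_mul hne) hq] at hd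
  rw [degree_eq_natDegree hq]
  exact_mod_cast (by omega)

theorem IsPosDef.orthP_splits (h : IsPosDef s) (n : ℕ) : (orthP s n).Splits := by
  refine Splits.of_splits_map (algebraMap ℝ ℂ) (IsAlgClosed.splits _) fun z hz => ?_
  by_contra hr
  have him : z.im ≠ 0 := fun h0 => hr ⟨z.re, Complex.ext rfl (by simp [h0])⟩
  have hz0 : aeval z (orthP s n) = 0 := by
    have := (mem_roots'.1 hz).2
    rwa [IsRoot.def, eval_map_algebraMap] at this
  obtain ⟨q, hq⟩ := quadratic_dvd_of_aeval_eq_zero_im_ne_zero _ hz0 him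
  have hm : (X ^ 2 - C (2 * z.re) * X + C (‖z‖ ^ 2) : ℝ[X]).natDegree = 2 := by
    compute_degree!
  obtain ⟨hq0, hqd⟩ := h.degree_cofactor_lt (by rw [hm]; norm_num) hq
  have h0 := h.orthP_mul_of_degree_lt hqd
  -- The quadratic factor of a nonreal root is `(X - Re z)² + (Im z)²`, so the functional would be
  -- strictly positive here.
  have e : orthP s n * q = ((X - C z.re) * q) * ((X - C z.re) * q) + C (z.im ^ 2) * (q * q) := by
    rw [hq, Complex.sq_norm, Complex.normSq_apply]
    simp only [C_mul, C_add, C_pow, C_ofNat]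
    ring
  rw [e, map_add, momentFunctional_C_mul] at h0
  have h1 := h.pos _ (mul_ne_zero (X_sub_C_ne_zero z.re) hq0)
  have h2 := h.pos _ hq0
  have h3 : 0 < z.im ^ 2 := by positivity
  nlinarith [mul_pos h3 h2]

theorem IsPosDef.orthP_roots_nodup (h : IsPosDef s) (n : ℕ) : (orthP s n).roots.Nodup := by
  rw [Multiset.nodup_iff_count_le_one]
  intro r
  rw [count_roots]
  by_contra! hr
  obtain ⟨q, hq⟩ := (le_rootMultiplicity_iff (h.orthP_ne_zero n)).1 hr
  obtain ⟨hq0, hqd⟩ := h.degree_cofactor_lt (by rw [natDegree_pow, natDegree_X_sub_C]; norm_num) hq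
  have h0 := h.orthP_mul_of_degree_lt hqd
  have e : orthP s n * q = ((X - C r) * q) * ((X - C r) * q) := by rw [hq]; ring
  rw [e] at h0
  exact (h.pos _ (mul_ne_zero (X_sub_C_ne_zero r) hq0)).ne' h0

/-- The zeros of `P_n`. -/
def nodes (s : ℕ → ℝ) (n : ℕ) : Finset ℝ := (orthP s n).roots.toFinset

theorem IsPosDef.mem_nodes (h : IsPosDef s) {n : ℕ} {x : ℝ} :
    x ∈ nodes s n ↔ (orthP s n).eval x = 0 := by
  rw [nodes, Multiset.mem_toFinset, mem_roots (h.orthP_ne_zero n), IsRoot.def]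

theorem IsPosDef.card_nodes (h : IsPosDef s) (n : ℕ) : (nodes s n).card = n := by
  rw [nodes, Multiset.toFinset_card_of_nodup (h.orthP_roots_nodup n),
    ← (h.orthP_splits n).natDegree_eq_card_roots, h.orthP_natDegree]

/-- For a zero `r ≤ p` the integrand `(x - r) q²` is nonnegative almost everywhere with integral
`0`, so `P_n` vanishes almost everywhere, against definiteness. This also excludes `r = p`. -/
theorem IsHamburgerSolution.lt_of_mem_nodes {ν : Measure ℝ} (hν : IsHamburgerSolution s ν)
    (h : IsPosDef s) {p : ℝ} (hp : ∀ᵐ x ∂ν, p ≤ x) {n : ℕ} {r : ℝ} (hr : r ∈ nodes s n) :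
    p < r := by
  by_contra! hrp
  obtain ⟨q, hq⟩ := dvd_iff_isRoot.2 (h.mem_nodes.1 hr)
  obtain ⟨hq0, hqd⟩ := h.degree_cofactor_lt (by rw [natDegree_X_sub_C]) hq
  have h0 := h.orthP_mul_of_degree_lt hqd
  rw [← hν.integral_eval, integral_eq_zero_iff_of_nonneg_ae _ (hν.integrable_eval _)] at h0
  · have h1 : ∫ x, (orthP s n * orthP s n).eval x ∂ν = 0 := by
      refine integral_eq_zero_of_ae ?_
      filter_upwards [h0] with x hx
      have e : orthP s n * orthP s n = (X - C r) * (orthP s n * q) := by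
        rw [hq]; ring
      rw [e, eval_mul, hx]
      simp
    rw [hν.integral_eval] at h1
    exact (h.pos _ (h.orthP_ne_zero n)).ne' h1
  · filter_upwards [hp] with x hx
    rw [hq]
    simp only [eval_mul, eval_sub, eval_X, eval_C, Pi.zero_apply]
    have : 0 ≤ x - r := by linarith
    rw [mul_assoc]
    exact mul_nonneg this (mul_self_nonneg _)

/-- Below all zeros, `P_n` has the sign `(-1)^n`. -/
theorem IsPosDef.neg_one_pow_mul_eval_pos (h : IsPosDef s) {n : ℕ} {y : ℝ}
    (hy : ∀ r ∈ nodes s n, y < r) : 0 < (-1) ^ n * (orthP s n).eval y := by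
  have hn : (-1 : ℝ) ^ n = ((orthP s n).roots.map fun _ => (-1 : ℝ)).prod := by
    rw [Multiset.map_const', Multiset.prod_replicate, ← (h.orthP_splits n).natDegree_eq_card_roots,
      h.orthP_natDegree]
  rw [(h.orthP_splits n).eval_eq_prod_roots, mul_left_comm, hn, ← Multiset.prod_map_mul]
  refine mul_pos (h.orthP_leadingCoeff_pos n) (Multiset.prod_pos ?_)
  intro a ha
  obtain ⟨r, hr, rfl⟩ := Multiset.mem_map.1 ha
  have := hy r (Multiset.mem_toFinset.2 hr)
  linarith

/-! ### Gauss quadrature -/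

/-- The weights of the Gauss quadrature. -/
def gaussWeight (s : ℕ → ℝ) (n : ℕ) (r : ℝ) : ℝ :=
  momentFunctional s (Lagrange.basis (nodes s n) id r)

/-- Division by `P_n` leaves a quotient of degree below `n`, killed by orthogonality, and a
remainder recovered by interpolation at the zeros. -/
theorem IsPosDef.gauss_quadrature (h : IsPosDef s) {n : ℕ} {p : ℝ[X]}
    (hp : p.degree < ((2 * n : ℕ) : WithBot ℕ)) :
    momentFunctional s p = ∑ r ∈ nodes s n, gaussWeight s n r * p.eval r := by
  have hne := h.orthP_ne_zero n
  have hmod : (p % orthP s n).degree < n := by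
    rw [← h.orthP_degree n]; exact degree_mod_lt _ hne
  have hdiv : (p / orthP s n).degree < n := by
    by_cases hle : (orthP s n).degree ≤ p.degree
    · have h1 := degree_add_div hne hle
      rw [h.orthP_degree] at h1
      by_cases hz : p / orthP s n = 0
      · rw [hz, degree_zero]; exact WithBot.bot_lt_coe n
      · rw [degree_eq_natDegree hz] at h1 ⊢
        rw [← h1] at hp
        have hp' : n + (p / orthP s n).natDegree < 2 * n := by exact_mod_cast hp
        exact_mod_cast (by omega : (p / orthP s n).natDegree < n)
    · rw [(Polynomial.div_eq_zero_iff hne).2 (not_le.1 hle), degree_zero]; exact WithBot.bot_lt_coe n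
  have e : p = orthP s n * (p / orthP s n) + p % orthP s n := (EuclideanDomain.div_add_mod _ _).symm
  have hev : ∀ r ∈ nodes s n, (p % orthP s n).eval r = p.eval r := by
    intro r hr
    conv_rhs => rw [e]
    rw [eval_add, eval_mul, h.mem_nodes.1 hr, zero_mul, zero_add]
  have hL : momentFunctional s p = momentFunctional s (p % orthP s n) := by
    conv_lhs => rw [e]
    rw [map_add, h.orthP_mul_of_degree_lt hdiv, zero_add]
  rw [hL, Lagrange.eq_interpolate (f := p % orthP s n) (s := nodes s n) (v := id)
    Function.injective_id.injOn
    (by rwa [h.card_nodes]), Lagrange.interpolate_apply, map_sum]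
  refine Finset.sum_congr rfl fun r hr => ?_
  rw [momentFunctional_C_mul, id, hev r hr, mul_comm, gaussWeight]

/-- The square of the Lagrange basis polynomial has degree `2n - 2`, so the quadrature is exact on
it and returns the weight. -/
theorem IsPosDef.gaussWeight_pos (h : IsPosDef s) {n : ℕ} {r : ℝ} (hr : r ∈ nodes s n) :
    0 < gaussWeight s n r := by
  have hn : 0 < n := by
    rw [← h.card_nodes n]; exact Finset.card_pos.2 ⟨r, hr⟩
  set ℓ := Lagrange.basis (nodes s n) id r with hℓ
  have hd : ℓ.degree = ((n - 1 : ℕ) : WithBot ℕ) := by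
    rw [hℓ, Lagrange.degree_basis Function.injective_id.injOn hr, h.card_nodes]
  have hℓ0 : ℓ ≠ 0 := by
    rintro h0
    rw [h0, degree_zero] at hd
    exact WithBot.bot_ne_coe hd
  have h1 := h.gauss_quadrature (n := n) (p := ℓ * ℓ) (by
    rw [degree_mul, hd]
    exact_mod_cast (by omega : n - 1 + (n - 1) < 2 * n))
  rw [Finset.sum_eq_single_of_mem r hr] at h1
  · have h2 : ℓ.eval r = 1 :=
      Lagrange.eval_basis_self (v := id) Function.injective_id.injOn hr
    rw [eval_mul, h2, mul_one, mul_one] at h1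
    rw [← h1]
    exact h.pos _ hℓ0
  · intro t ht htr
    have h2 : ℓ.eval t = 0 := Lagrange.eval_basis_of_ne (v := id) htr.symm ht
    rw [eval_mul, h2, mul_zero, mul_zero]

/-- The Gauss quadrature as a discrete measure. -/
def gaussMeasure (s : ℕ → ℝ) (n : ℕ) : Measure ℝ :=
  ∑ r ∈ nodes s n, ENNReal.ofReal (gaussWeight s n r) • Measure.dirac r

theorem integrable_gaussMeasure {F : Type*} [NormedAddCommGroup F] (s : ℕ → ℝ) (n : ℕ)
    (f : ℝ → F) : Integrable f (gaussMeasure s n) := by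
  rw [gaussMeasure, integrable_finsetSum_measure]
  exact fun r _ => (integrable_dirac (by simp)).smul_measure ENNReal.ofReal_ne_top

theorem IsPosDef.integral_gaussMeasure (h : IsPosDef s) {F : Type*} [NormedAddCommGroup F]
    [NormedSpace ℝ F] [CompleteSpace F] (n : ℕ) (f : ℝ → F) :
    ∫ x, f x ∂(gaussMeasure s n) = ∑ r ∈ nodes s n, gaussWeight s n r • f r := by
  rw [gaussMeasure, integral_finsetSum_measure]
  · refine Finset.sum_congr rfl fun r hr => ?_
    rw [integral_smul_measure, integral_dirac, ENNReal.toReal_ofReal (h.gaussWeight_pos hr).le]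
  · exact fun r _ => (integrable_dirac (by simp)).smul_measure ENNReal.ofReal_ne_top

theorem ae_mem_nodes_gaussMeasure (s : ℕ → ℝ) (n : ℕ) :
    ∀ᵐ x ∂(gaussMeasure s n), x ∈ nodes s n := by
  rw [ae_iff, gaussMeasure, Measure.finsetSum_apply]
  refine Finset.sum_eq_zero fun r hr => ?_
  simp [hr]

theorem IsPosDef.integral_eval_gaussMeasure (h : IsPosDef s) {n : ℕ} {p : ℝ[X]}
    (hp : p.degree < ((2 * n : ℕ) : WithBot ℕ)) :
    ∫ x, p.eval x ∂(gaussMeasure s n) = momentFunctional s p := by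
  rw [h.integral_gaussMeasure, h.gauss_quadrature hp]
  simp

theorem IsPosDef.isProbabilityMeasure_gaussMeasure (h : IsPosDef s) {n : ℕ} (hn : n ≠ 0) :
    IsProbabilityMeasure (gaussMeasure s n) := by
  have h1 := h.gauss_quadrature (n := n) (p := 1) (by
    rw [degree_one]; exact_mod_cast (by omega : 0 < 2 * n))
  constructor
  rw [gaussMeasure, Measure.finsetSum_apply]
  simp only [Measure.smul_apply, measure_univ, smul_eq_mul, mul_one]
  rw [← ENNReal.ofReal_sum_of_nonneg fun r hr => (h.gaussWeight_pos hr).le]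
  simp only [eval_one, mul_one] at h1
  rw [← h1, h.map_one, ENNReal.ofReal_one]

/-! ### The smallest zero -/

theorem IsPosDef.smallestZero_mem (h : IsPosDef s) {n : ℕ} (hn : n ≠ 0) :
    smallestZero s n ∈ nodes s n := by
  have e : {x : ℝ | (orthP s n).eval x = 0} = (nodes s n : Set ℝ) := by
    ext x; exact h.mem_nodes.symm
  have hne : (nodes s n).Nonempty := by
    rw [← Finset.card_pos, h.card_nodes]; omega
  rw [smallestZero, e, ← Finset.mem_coe]
  exact hne.csInf_mem

theorem IsPosDef.smallestZero_le (h : IsPosDef s) {n : ℕ} {r : ℝ} (hr : r ∈ nodes s n) :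
    smallestZero s n ≤ r := by
  have e : {x : ℝ | (orthP s n).eval x = 0} = (nodes s n : Set ℝ) := by
    ext x; exact h.mem_nodes.symm
  rw [smallestZero, e]
  exact csInf_le (nodes s n).finite_toSet.bddBelow hr

/-- Otherwise, with `m` the smallest zero of `P_n`, the product `P_n q = (X - m) q²` is nonnegative
at all zeros of `P_{n+1}`. Its quadrature sum vanishes by orthogonality, so `q` has `n + 1` zeros
but degree below `n`. -/
theorem IsPosDef.smallestZero_succ_le (h : IsPosDef s) {n : ℕ} (hn : n ≠ 0) :
    smallestZero s (n + 1) ≤ smallestZero s n := by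
  by_contra! hlt
  set m := smallestZero s n
  obtain ⟨q, hq⟩ := dvd_iff_isRoot.2 (h.mem_nodes.1 (h.smallestZero_mem hn))
  obtain ⟨hq0, hqd⟩ := h.degree_cofactor_lt (by rw [natDegree_X_sub_C]) hq
  have h0 := h.orthP_mul_of_degree_lt hqd
  rw [h.gauss_quadrature (n := n + 1)] at h0
  · have hz : ∀ r ∈ nodes s (n + 1), gaussWeight s (n + 1) r * (orthP s n * q).eval r = 0 := by
      rw [← Finset.sum_eq_zero_iff_of_nonneg]
      · exact h0
      · intro r hr
        have h1 := h.smallestZero_le hr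
        have h2 : 0 ≤ r - m := by linarith
        rw [hq]
        simp only [eval_mul, eval_sub, eval_X, eval_C]
        rw [mul_assoc]
        exact mul_nonneg (h.gaussWeight_pos hr).le (mul_nonneg h2 (mul_self_nonneg _))
    have hsub : nodes s (n + 1) ⊆ q.roots.toFinset := by
      intro r hr
      have h1 := h.smallestZero_le hr
      have h2 : r - m ≠ 0 := by linarith
      have h3 := (mul_eq_zero.1 (hz r hr)).resolve_left (h.gaussWeight_pos hr).ne'
      rw [hq] at h3
      simp only [eval_mul, eval_sub, eval_X, eval_C, mul_eq_zero] at h3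
      rw [Multiset.mem_toFinset, mem_roots hq0]
      rcases h3 with (h3 | h3) | h3
      · exact absurd h3 h2
      · exact h3
      · exact h3
    have hc := Finset.card_le_card hsub
    rw [h.card_nodes] at hc
    have hc2 := (Multiset.toFinset_card_le q.roots).trans (card_roots' q)
    rw [degree_eq_natDegree hq0] at hqd
    have : q.natDegree < n := by exact_mod_cast hqd
    omega
  · rw [degree_mul, h.orthP_degree]
    rw [degree_eq_natDegree hq0] at hqd ⊢
    have : q.natDegree < n := by exact_mod_cast hqd
    exact_mod_cast (by omega : n + q.natDegree < 2 * (n + 1))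

theorem IsPosDef.exists_tendsto_smallestZero (h : IsPosDef s) {p : ℝ}
    (hp : ∀ n, ∀ r ∈ nodes s n, p ≤ r) :
    ∃ ξ, Tendsto (smallestZero s) atTop (𝓝 ξ) ∧ ∀ n, ∀ r ∈ nodes s n, ξ ≤ r := by
  -- The index starts at `1`: `P_0` has no zero, and `sInf ∅ = 0` is a meaningless value there.
  have hanti : Antitone fun n => smallestZero s (n + 1) :=
    antitone_nat_of_succ_le fun n => h.smallestZero_succ_le n.succ_ne_zero
  have hbdd : BddBelow (Set.range fun n => smallestZero s (n + 1)) :=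
    ⟨p, by rintro _ ⟨n, rfl⟩; exact hp _ _ (h.smallestZero_mem n.succ_ne_zero)⟩
  refine ⟨_, (tendsto_add_atTop_iff_nat 1).1 (tendsto_atTop_ciInf hanti hbdd), fun n r hr => ?_⟩
  obtain ⟨k, rfl⟩ : ∃ k, n = k + 1 := Nat.exists_eq_succ_of_ne_zero fun h0 => by
    have := h.card_nodes n
    rw [h0, Finset.card_eq_zero] at this
    rw [h0, this] at hr
    simp at hr
  exact (ciInf_le hbdd k).trans (h.smallestZero_le hr)

/-! ### Stieltjes transforms left of the support -/

theorem pAt_real (s : ℕ → ℝ) (y : ℝ) (k : ℕ) : pAt s y k = (orthP s k).eval y := by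
  rw [pAt, coe_aeval_eq_eval]

theorem qAt_real (s : ℕ → ℝ) (y : ℝ) (k : ℕ) : qAt s y k = (orthQ s k).eval y := by
  rw [qAt, coe_aeval_eq_eval]

theorem aeval_ofReal_eq (y : ℝ) (p : ℝ[X]) : aeval (y : ℂ) p = ((aeval y p : ℝ) : ℂ) :=
  aeval_algebraMap_apply ℂ y p

/-- The integrals of `P_n(x) / (x - z)` are `Q_n(z) + w P_n(z)`, where `w` is the Stieltjes
transform at `z`. -/
theorem IsPosDef.integral_orthP_div {𝕜 : Type*} [RCLike 𝕜] (h : IsPosDef s) {m : Measure ℝ} {z : 𝕜}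
    (hne : ∀ᵐ x : ℝ ∂m, (x : 𝕜) - z ≠ 0)
    (hP : ∀ k, Integrable (fun x => (orthP s k).eval x) m)
    (hPz : ∀ k, Integrable (fun x : ℝ => (((orthP s k).eval x : ℝ) : 𝕜) / ((x : 𝕜) - z)) m) {N : ℕ}
    (hN : ∀ k < N, ∫ x, (orthP s k).eval x ∂m = if k = 0 then 1 else 0) :
    ∀ n ≤ N, ∫ x : ℝ, (((orthP s n).eval x : ℝ) : 𝕜) / ((x : 𝕜) - z) ∂m =
      qAt s z n + (∫ x : ℝ, 1 / ((x : 𝕜) - z) ∂m) * pAt s z n := by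
  set c : ℕ → 𝕜 := fun n => ∫ x : ℝ, (((orthP s n).eval x : ℝ) : 𝕜) / ((x : 𝕜) - z) ∂m with hc
  have hc0 : ∫ x : ℝ, 1 / ((x : 𝕜) - z) ∂m = c 0 := by simp [hc, h.orthP_zero]
  -- Since `x / (x - z) = 1 + z / (x - z)`, the integrals `c k` obey the three-term recurrence as
  -- long as `∫ P_k = 0`. The cutoff `N` admits Gauss quadratures, which reproduce only finitely
  -- many moments.
  have hX : ∀ k, ∫ x : ℝ, ((x * (orthP s k).eval x : ℝ) : 𝕜) / ((x : 𝕜) - z) ∂m =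
      ((∫ x, (orthP s k).eval x ∂m : ℝ) : 𝕜) + z * c k := by
    intro k
    rw [← integral_ofReal, hc, ← integral_const_mul, ← integral_add (hP k).ofReal
      ((hPz k).const_mul z)]
    refine integral_congr_ae ?_
    filter_upwards [hne] with x hx
    push_cast
    field_simp
    ring
  have h0 : 0 < N → z * c 0 + 1 = (jacobiB s 0 : 𝕜) * c 1 + (jacobiA s 0 : 𝕜) * c 0 := by
    intro hN0
    have h1 := hX 0
    rw [hN 0 hN0, if_pos rfl, RCLike.ofReal_one] at h1
    rw [add_comm, ← h1, hc, ← integral_const_mul, ← integral_const_mul,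
      ← integral_add ((hPz 1).const_mul _) ((hPz 0).const_mul _)]
    refine integral_congr_ae (Eventually.of_forall fun x => ?_)
    have h2 := congrArg (eval x) h.X_mul_orthP_zero
    simp only [eval_mul, eval_add, eval_X, eval_C] at h2
    simp only [h2]
    push_cast
    ring
  have hs : ∀ n, n + 1 < N → z * c (n + 1) = (jacobiB s (n + 1) : 𝕜) * c (n + 2) +
      (jacobiA s (n + 1) : 𝕜) * c (n + 1) + (jacobiB s n : 𝕜) * c n := by
    intro n hn
    have h1 := hX (n + 1)
    rw [hN (n + 1) hn, if_neg n.succ_ne_zero, RCLike.ofReal_zero, zero_add] at h1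
    have hi : Integrable (fun x : ℝ =>
        (jacobiB s (n + 1) : 𝕜) * ((((orthP s (n + 2)).eval x : ℝ) : 𝕜) / ((x : 𝕜) - z)) +
        (jacobiA s (n + 1) : 𝕜) * ((((orthP s (n + 1)).eval x : ℝ) : 𝕜) / ((x : 𝕜) - z))) m :=
      ((hPz (n + 2)).const_mul _).add ((hPz (n + 1)).const_mul _)
    rw [← h1, hc, ← integral_const_mul, ← integral_const_mul, ← integral_const_mul,
      ← integral_add ((hPz (n + 2)).const_mul _) ((hPz (n + 1)).const_mul _),
      ← integral_add hi ((hPz n).const_mul _)]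
    refine integral_congr_ae (Eventually.of_forall fun x => ?_)
    have h2 := congrArg (eval x) (h.X_mul_orthP_succ n)
    simp only [eval_mul, eval_add, eval_X, eval_C] at h2
    simp only [h2]
    push_cast
    ring
  rw [hc0]
  have base : c 0 = qAt s z 0 + c 0 * pAt s z 0 := by rw [qAt_zero, h.pAt_zero]; ring
  have main : ∀ n, (n ≤ N → c n = qAt s z n + c 0 * pAt s z n) ∧
      (n + 1 ≤ N → c (n + 1) = qAt s z (n + 1) + c 0 * pAt s z (n + 1)) := by
    intro n
    induction n with
    | zero =>
      refine ⟨fun _ => base, fun hN0 => mul_left_cancel₀ (h.ofReal_jacobiB_ne_zero (𝕜 := 𝕜) 0) ?_⟩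
      linear_combination - h0 hN0 + c 0 * h.pAt_rec_zero z - h.jacobiB_mul_qAt_one z
    | succ n ih =>
      refine ⟨ih.2, fun hN1 => mul_left_cancel₀ (h.ofReal_jacobiB_ne_zero (𝕜 := 𝕜) (n + 1)) ?_⟩
      have e1 := ih.1 (by omega)
      have e2 := ih.2 (by omega)
      linear_combination - hs n (by omega) + c 0 * h.pAt_rec z n + h.qAt_rec z n +
        (z - (jacobiA s (n + 1) : 𝕜)) * e2 - (jacobiB s n : 𝕜) * e1
  exact fun n hn => (main n).1 hn

theorem eval_eq_add_mul_divByMonic (q : ℝ[X]) (x y : ℝ) :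
    q.eval x = q.eval y + (x - y) * (q /ₘ (X - C y)).eval x := by
  have := congrArg (eval x) (modByMonic_add_div q (X - C y))
  rw [modByMonic_X_sub_C_eq_C_eval] at this
  simpa using this.symm

theorem IsPosDef.momentFunctional_orthP (h : IsPosDef s) (k : ℕ) :
    momentFunctional s (orthP s k) = if k = 0 then 1 else 0 := by
  have := h.orthP_mul_orthP k 0
  rwa [h.orthP_zero, mul_one] at this

namespace IsHamburgerSolution

variable {ν : Measure ℝ} {p y : ℝ}

theorem integrable_eval_div (hν : IsHamburgerSolution s ν) (hp : ∀ᵐ x ∂ν, p ≤ x) (hy : y < p)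
    (q : ℝ[X]) : Integrable (fun x => q.eval x / (x - y)) ν := by
  refine ((hν.integrable_eval q).norm.mul_const (1 / (p - y))).mono' ?_ ?_
  · exact ((by fun_prop : Measurable fun x : ℝ => q.eval x / (x - y))).aestronglyMeasurable
  · filter_upwards [hp] with x hx
    have h1 : 0 < p - y := by linarith
    have h2 : p - y ≤ x - y := by linarith
    rw [norm_div, Real.norm_of_nonneg (by linarith : 0 ≤ x - y), div_eq_mul_one_div]
    exact mul_le_mul_of_nonneg_left (one_div_le_one_div_of_le h1 h2) (norm_nonneg _)

theorem integral_orthP_div (hν : IsHamburgerSolution s ν) (h : IsPosDef s)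
    (hp : ∀ᵐ x ∂ν, p ≤ x) (hy : y < p) (n : ℕ) :
    ∫ x, (orthP s n).eval x / (x - y) ∂ν = qAt s y n + (∫ x, 1 / (x - y) ∂ν) * pAt s y n := by
  refine h.integral_orthP_div (𝕜 := ℝ) (z := y) ?_ (fun k => hν.integrable_eval _)
    (fun k => hν.integrable_eval_div hp hy _) (N := n) (fun k _ => ?_) n le_rfl
  · filter_upwards [hp] with x hx
    have : y < x := by linarith
    exact (sub_pos.2 this).ne'
  · rw [hν.integral_eval, h.momentFunctional_orthP]

/-- The Gauss quadratures bound the Stieltjes transform from below. -/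
theorem orthP_mul_nonneg (hν : IsHamburgerSolution s ν) (h : IsPosDef s)
    (hp : ∀ᵐ x ∂ν, p ≤ x) (hy : y < p) (n : ℕ) :
    0 ≤ pAt s y n * (qAt s y n + (∫ x, 1 / (x - y) ∂ν) * pAt s y n) := by
  set P := orthP s n with hP
  set r := P /ₘ (X - C y) with hr
  have hrd : r.degree < n := by
    rw [← h.orthP_degree n]
    exact degree_divByMonic_lt _ _ (h.orthP_ne_zero n) (by rw [degree_X_sub_C]; exact zero_lt_one)
  -- Splitting one factor as `P(x) = P(y) + (x - y) r(x)` leaves only the `P(y)` term, by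
  -- orthogonality to `r`; the left side is nonnegative.
  have e : ∫ x, P.eval x * P.eval x / (x - y) ∂ν =
      ∫ x, ((P * r).eval x + P.eval y * (P.eval x / (x - y))) ∂ν := by
    refine integral_congr_ae ?_
    filter_upwards [hp] with x hx
    have h1 : x - y ≠ 0 := by linarith
    rw [eval_mul]
    have h2 := eval_eq_add_mul_divByMonic P x y
    rw [← hr] at h2
    field_simp
    linear_combination P.eval x * h2
  rw [integral_add (hν.integrable_eval _) ((hν.integrable_eval_div hp hy P).const_mul _),
    hν.integral_eval, h.orthP_mul_of_degree_lt hrd, zero_add, integral_const_mul,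
    hν.integral_orthP_div h hp hy, hP, ← pAt_real] at e
  rw [← e]
  refine integral_nonneg_of_ae ?_
  filter_upwards [hp] with x hx
  exact div_nonneg (mul_self_nonneg _) (by linarith)

theorem integral_kernel_div (hν : IsHamburgerSolution s ν) (h : IsPosDef s)
    (hp : ∀ᵐ x ∂ν, p ≤ x) (hy : y < p) (n : ℕ) (c : ℕ → ℝ) :
    ∫ x, (∑ k ∈ Finset.range n, C (c k) * orthP s k).eval x / (x - y) ∂ν =
      ∑ k ∈ Finset.range n, c k * (qAt s y k + (∫ x, 1 / (x - y) ∂ν) * pAt s y k) := by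
  simp only [eval_finsetSum, eval_mul, eval_C, Finset.sum_div, mul_div_assoc]
  rw [integral_finsetSum _ fun k _ => (hν.integrable_eval_div hp hy _).const_mul _]
  refine Finset.sum_congr rfl fun k _ => ?_
  rw [integral_const_mul, hν.integral_orthP_div h hp hy]

/-- The quadratures with a node at `p` bound the Stieltjes transform from above. -/
theorem kernel_mul_nonneg (hν : IsHamburgerSolution s ν) (h : IsPosDef s)
    (hp : ∀ᵐ x ∂ν, p ≤ x) (hy : y < p) {n : ℕ} (hn : n ≠ 0) :
    0 ≤ (∑ k ∈ Finset.range n, pAt s p k * pAt s y k) * (1 + (y - p) * ∑ k ∈ Finset.range n,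
      pAt s p k * (qAt s y k + (∫ x, 1 / (x - y) ∂ν) * pAt s y k)) := by
  set K : ℝ[X] := ∑ k ∈ Finset.range n, C ((orthP s k).eval p) * orthP s k with hK
  set r := K /ₘ (X - C y) with hr
  have hKd : K.degree < n := by
    rw [← mem_degreeLT]
    refine Submodule.sum_mem _ fun k hk => ?_
    rw [← smul_eq_C_mul]
    refine Submodule.smul_mem _ _ ?_
    rw [mem_degreeLT, h.orthP_degree]
    exact_mod_cast Finset.mem_range.1 hk
  -- Replacing `p` by `y` keeps the degree and turns the product into `K - K(y)`.
  have hrd : ((X - C p) * r).degree < (n : WithBot ℕ) := by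
    have e1 : ((X - C p) * r).degree = ((X - C y) * r).degree := by
      rw [degree_mul, degree_mul, degree_X_sub_C, degree_X_sub_C]
    have e2 : (X - C y) * r = K - C (K.eval y) := by
      have := modByMonic_add_div K (X - C y)
      rw [modByMonic_X_sub_C_eq_C_eval] at this
      exact eq_sub_of_add_eq' this
    rw [e1, e2]
    refine (degree_sub_le _ _).trans_lt (max_lt hKd (degree_C_le.trans_lt ?_))
    exact_mod_cast Nat.pos_of_ne_zero hn
  have hK1 : momentFunctional s K = 1 := by
    have := h.kernel_reproducing n p (q := 1) (by
      rw [degree_one]; exact_mod_cast Nat.pos_of_ne_zero hn)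
    rwa [mul_one, eval_one] at this
  have hKy : K.eval y = ∑ k ∈ Finset.range n, pAt s p k * pAt s y k := by
    simp [hK, eval_finsetSum, pAt_real]
  -- Here `K(x) = K(y) + (x - y) r(x)` and `(x - p) / (x - y) = 1 + (y - p) / (x - y)`. The kernel
  -- evaluates `(X - p) r` at `p`, so that term vanishes.
  have e : ∫ x, (x - p) * (K.eval x * K.eval x) / (x - y) ∂ν =
      ∫ x, ((K * ((X - C p) * r)).eval x +
        K.eval y * (K.eval x + (y - p) * (K.eval x / (x - y)))) ∂ν := by
    refine integral_congr_ae ?_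
    filter_upwards [hp] with x hx
    have h1 : x - y ≠ 0 := by linarith
    simp only [eval_mul, eval_sub, eval_X, eval_C]
    have h2 := eval_eq_add_mul_divByMonic K x y
    rw [← hr] at h2
    field_simp
    linear_combination (x - p) * K.eval x * h2
  have hi1 := (hν.integrable_eval_div hp hy K).const_mul (y - p)
  have hi2 : Integrable (fun x => K.eval x + (y - p) * (K.eval x / (x - y))) ν :=
    (hν.integrable_eval K).add hi1
  rw [integral_add (hν.integrable_eval _) (hi2.const_mul _), hν.integral_eval,
    h.kernel_reproducing n p hrd, integral_const_mul, integral_add (hν.integrable_eval K) hi1,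
    integral_const_mul, hν.integral_eval, hK1, hKy,
    hν.integral_kernel_div h hp hy] at e
  simp only [eval_mul, eval_sub, eval_X, eval_C, sub_self, zero_mul, zero_add, ← pAt_real] at e
  rw [← e]
  refine integral_nonneg_of_ae ?_
  filter_upwards [hp] with x hx
  exact div_nonneg (mul_nonneg (by linarith) (mul_self_nonneg _)) (by linarith)

/-- Bessel's inequality for `1 / (x - y)`. -/
theorem summable_coeff_sq (hν : IsHamburgerSolution s ν) (h : IsPosDef s)
    (hp : ∀ᵐ x ∂ν, p ≤ x) (hy : y < p) :
    Summable fun k => (qAt s y k + (∫ x, 1 / (x - y) ∂ν) * pAt s y k) ^ 2 := by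
  have := hν.isProbabilityMeasure
  set c : ℕ → ℝ := fun k => qAt s y k + (∫ x, 1 / (x - y) ∂ν) * pAt s y k with hc
  refine summable_of_sum_range_le (c := ∫ x, (1 / (x - y)) ^ 2 ∂ν) (fun k => sq_nonneg _)
    fun n => ?_
  set q : ℝ[X] := ∑ k ∈ Finset.range n, C (c k) * orthP s k with hq
  have hqq : momentFunctional s (q * q) = ∑ k ∈ Finset.range n, c k ^ 2 := by
    conv_lhs => rw [hq, Finset.sum_mul, map_sum]
    refine Finset.sum_congr rfl fun k hk => ?_
    rw [Finset.mul_sum, map_sum, Finset.sum_eq_single_of_mem k hk]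
    · rw [mul_mul_mul_comm, ← C_mul, momentFunctional_C_mul, h.orthP_mul_orthP, if_pos rfl]
      ring
    · intro j _ hjk
      rw [mul_mul_mul_comm, ← C_mul, momentFunctional_C_mul, h.orthP_mul_orthP,
        if_neg hjk.symm, mul_zero]
  have hsq : Integrable (fun x => (1 / (x - y)) ^ 2) ν := by
    refine (integrable_const ((1 / (p - y)) ^ 2)).mono'
      (by fun_prop : Measurable fun x : ℝ => (1 / (x - y)) ^ 2).aestronglyMeasurable ?_
    filter_upwards [hp] with x hx
    have h1 : 0 < p - y := by linarith
    have h2 : p - y ≤ x - y := by linarith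
    have h3 : 0 < x - y := by linarith
    rw [Real.norm_of_nonneg (sq_nonneg _)]
    exact pow_le_pow_left₀ (by positivity) (one_div_le_one_div_of_le h1 h2) 2
  -- The numbers `c k` are the Fourier coefficients of `1 / (x - y)`; the integrand is the squared
  -- distance to the partial sum `q`.
  have h0 : 0 ≤ ∫ x, ((1 / (x - y)) ^ 2 + ((q * q).eval x - 2 * (q.eval x / (x - y)))) ∂ν := by
    refine integral_nonneg fun x => ?_
    have : (1 / (x - y)) ^ 2 + ((q * q).eval x - 2 * (q.eval x / (x - y))) =
        (1 / (x - y) - q.eval x) ^ 2 := by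
      rw [eval_mul]; ring
    simp only [this, Pi.zero_apply]
    exact sq_nonneg _
  have hi1 := (hν.integrable_eval_div hp hy q).const_mul 2
  have hi2 : Integrable (fun x => (q * q).eval x - 2 * (q.eval x / (x - y))) ν :=
    (hν.integrable_eval _).sub hi1
  rw [integral_add hsq hi2, integral_sub (hν.integrable_eval _) hi1,
    integral_const_mul, hν.integral_eval, hqq, hν.integral_kernel_div h hp hy] at h0
  have e : ∑ k ∈ Finset.range n, c k * (qAt s y k + (∫ x, 1 / (x - y) ∂ν) * pAt s y k) =
      ∑ k ∈ Finset.range n, c k ^ 2 := Finset.sum_congr rfl fun k _ => by rw [sq]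
  rw [e] at h0
  linarith

end IsHamburgerSolution

/-- Two solutions on a half-line make the problem limit-circle. -/
theorem IsPosDef.isSquareSummable_of_ne (h : IsPosDef s) {μ ν : Measure ℝ}
    (hμ : IsHamburgerSolution s μ) (hν : IsHamburgerSolution s ν) {p : ℝ}
    (hμp : ∀ᵐ x ∂μ, p ≤ x) (hνp : ∀ᵐ x ∂ν, p ≤ x) (hne : μ ≠ ν) : IsSquareSummable s := by
  have := hμ.isProbabilityMeasure
  have := hν.isProbabilityMeasure
  obtain ⟨y, hy, hw⟩ : ∃ y < p, ∫ x, 1 / (x - y) ∂μ ≠ ∫ x, 1 / (x - y) ∂ν := by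
    by_contra! hall
    exact hne (ext_of_stieltjes_eq_of_lt hμp hνp hall)
  have h1 := hμ.summable_coeff_sq h hμp hy
  have h2 := hν.summable_coeff_sq h hνp hy
  set w₁ := ∫ x, 1 / (x - y) ∂μ
  set w₂ := ∫ x, 1 / (x - y) ∂ν
  -- `(w₁ - w₂) P_k(y)` is the difference of two square-summable coefficient sequences.
  have hP : Summable fun k => pAt s y k ^ 2 := by
    have hd : 0 < (w₁ - w₂) ^ 2 := by
      have := sub_ne_zero.2 hw
      positivity
    refine Summable.of_nonneg_of_le (fun k => sq_nonneg _) (fun k => ?_)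
      ((h1.add h2).mul_left (2 / (w₁ - w₂) ^ 2))
    rw [div_mul_eq_mul_div, le_div_iff₀ hd]
    nlinarith [sq_nonneg ((qAt s y k + w₁ * pAt s y k) + (qAt s y k + w₂ * pAt s y k))]
  have hQ : Summable fun k => qAt s y k ^ 2 := by
    refine Summable.of_nonneg_of_le (fun k => sq_nonneg _) (fun k => ?_)
      ((h1.mul_left 2).add (hP.mul_left (2 * w₁ ^ 2)))
    nlinarith [sq_nonneg (qAt s y k + 2 * (w₁ * pAt s y k))]
  refine h.isSquareSummable (y : ℂ) ?_ ?_
  · refine hP.congr fun k => ?_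
    rw [pAt, pAt, aeval_ofReal_eq, Complex.norm_real, Real.norm_eq_abs, sq_abs]
  · refine hQ.congr fun k => ?_
    rw [qAt, qAt, aeval_ofReal_eq, Complex.norm_real, Real.norm_eq_abs, sq_abs]

namespace IsSquareSummable

theorem exists_dominating (hS : IsSquareSummable s) (R : ℝ) :
    ∃ d : ℕ → ℝ, Summable d ∧ ∀ v z : ℂ, ‖v‖ ≤ R → ‖z‖ ≤ R → ∀ k,
      ‖pAt s v k * pAt s z k‖ ≤ d k ∧ ‖qAt s v k * pAt s z k‖ ≤ d k ∧
      ‖pAt s v k * qAt s z k‖ ≤ d k ∧ ‖qAt s v k * qAt s z k‖ ≤ d k := by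
  obtain ⟨e, he, hes, hM⟩ := hS
  obtain ⟨M, hM0, hM⟩ := hM R
  refine ⟨fun k => (M * M) * e k ^ 2, hes.mul_left _, fun v z hv hz k => ?_⟩
  obtain ⟨h1, h2⟩ := hM v hv k
  obtain ⟨h3, h4⟩ := hM z hz k
  have e1 : M * M * e k ^ 2 = (M * e k) * (M * e k) := by ring
  have h5 : 0 ≤ M * e k := mul_nonneg hM0 (he k)
  simp only [norm_mul, e1]
  exact ⟨mul_le_mul h1 h3 (norm_nonneg _) h5, mul_le_mul h2 h3 (norm_nonneg _) h5,
    mul_le_mul h1 h4 (norm_nonneg _) h5, mul_le_mul h2 h4 (norm_nonneg _) h5⟩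

theorem summable_mul (hS : IsSquareSummable s) (v z : ℂ) :
    (Summable fun k => pAt s v k * pAt s z k) ∧ (Summable fun k => qAt s v k * pAt s z k) ∧
      (Summable fun k => pAt s v k * qAt s z k) ∧ (Summable fun k => qAt s v k * qAt s z k) := by
  obtain ⟨d, hd, h⟩ := hS.exists_dominating (max ‖v‖ ‖z‖)
  have h := h v z (le_max_left _ _) (le_max_right _ _)
  exact ⟨hd.of_norm_bounded fun k => (h k).1, hd.of_norm_bounded fun k => (h k).2.1,
    hd.of_norm_bounded fun k => (h k).2.2.1, hd.of_norm_bounded fun k => (h k).2.2.2⟩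

theorem exists_dominating_real (hS : IsSquareSummable s) (R : ℝ) :
    ∃ d : ℕ → ℝ, Summable d ∧ ∀ v z : ℝ, |v| ≤ R → |z| ≤ R → ∀ k,
      ‖pAt s v k * pAt s z k‖ ≤ d k ∧ ‖qAt s v k * pAt s z k‖ ≤ d k ∧
      ‖pAt s v k * qAt s z k‖ ≤ d k ∧ ‖qAt s v k * qAt s z k‖ ≤ d k := by
  obtain ⟨d, hd, h⟩ := hS.exists_dominating R
  refine ⟨d, hd, fun v z hv hz k => ?_⟩
  have := h v z (by rwa [Complex.norm_real]) (by rwa [Complex.norm_real]) k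
  simpa only [pAt, qAt, aeval_ofReal_eq, ← Complex.ofReal_mul, Complex.norm_real] using this

theorem summable_mul_real (hS : IsSquareSummable s) (v z : ℝ) :
    (Summable fun k => pAt s v k * pAt s z k) ∧ (Summable fun k => qAt s v k * pAt s z k) ∧
      (Summable fun k => pAt s v k * qAt s z k) ∧ (Summable fun k => qAt s v k * qAt s z k) := by
  obtain ⟨d, hd, h⟩ := hS.exists_dominating_real (max |v| |z|)
  have h := h v z (le_max_left _ _) (le_max_right _ _)
  exact ⟨hd.of_norm_bounded fun k => (h k).1, hd.of_norm_bounded fun k => (h k).2.1,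
    hd.of_norm_bounded fun k => (h k).2.2.1, hd.of_norm_bounded fun k => (h k).2.2.2⟩

end IsSquareSummable

/-! ### The ratios `-Q_n(p) / P_n(p)` below the zeros -/

section Ratio

variable {p : ℝ}

theorem IsPosDef.pAt_ne_zero (h : IsPosDef s) (hp : ∀ n, ∀ r ∈ nodes s n, p < r) (n : ℕ) :
    pAt s p n ≠ 0 := by
  have := h.neg_one_pow_mul_eval_pos (hp n)
  rw [pAt_real]
  exact right_ne_zero_of_mul this.ne'

theorem IsPosDef.pAt_mul_pAt_pos (h : IsPosDef s) (hp : ∀ n, ∀ r ∈ nodes s n, p < r) {y : ℝ}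
    (hy : y ≤ p) (n : ℕ) : 0 < pAt s p n * pAt s y n := by
  have h1 := h.neg_one_pow_mul_eval_pos (hp n)
  have h2 := h.neg_one_pow_mul_eval_pos (y := y) fun r hr => hy.trans_lt (hp n r hr)
  have h3 := mul_pos h1 h2
  rw [mul_mul_mul_comm, ← mul_pow] at h3
  simpa [pAt_real] using h3

/-- The increment is the positive Wronskian divided by `-P_n(p) P_{n+1}(p)`, positive because
consecutive signs alternate below the zeros. -/
theorem IsPosDef.strictMono_ratio (h : IsPosDef s) (hp : ∀ n, ∀ r ∈ nodes s n, p < r) :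
    StrictMono fun n => -qAt s p n / pAt s p n := by
  refine strictMono_nat_of_lt_succ fun n => ?_
  have h1 := h.pAt_ne_zero hp n
  have h2 := h.pAt_ne_zero hp (n + 1)
  have hW : jacobiB s n * (qAt s p (n + 1) * pAt s p n - qAt s p n * pAt s p (n + 1)) = 1 :=
    h.wronskian p n
  have hb := h.jacobiB_pos n
  have hneg : pAt s p n * pAt s p (n + 1) < 0 := by
    have h3 := mul_pos (h.neg_one_pow_mul_eval_pos (hp n)) (h.neg_one_pow_mul_eval_pos (hp (n + 1)))
    have h4 : (-1 : ℝ) ^ n * (-1) ^ (n + 1) = -1 := by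
      rw [pow_succ, ← mul_assoc, ← mul_pow]
      norm_num
    rw [mul_mul_mul_comm, h4] at h3
    rw [pAt_real, pAt_real]
    linarith
  have hW' : 0 < qAt s p (n + 1) * pAt s p n - qAt s p n * pAt s p (n + 1) :=
    pos_of_mul_pos_right (by rw [hW]; exact one_pos) hb.le
  have e : -qAt s p (n + 1) / pAt s p (n + 1) - -qAt s p n / pAt s p n =
      (qAt s p (n + 1) * pAt s p n - qAt s p n * pAt s p (n + 1)) /
        -(pAt s p n * pAt s p (n + 1)) := by
    field_simp
    ring
  have : 0 < -qAt s p (n + 1) / pAt s p (n + 1) - -qAt s p n / pAt s p n := by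
    rw [e]; exact div_pos hW' (neg_pos.2 hneg)
  linarith

theorem IsPosDef.ratio_pos (h : IsPosDef s) (hp : ∀ n, ∀ r ∈ nodes s n, p < r) {n : ℕ}
    (hn : n ≠ 0) : 0 < -qAt s p n / pAt s p n := by
  have := h.strictMono_ratio hp (Nat.pos_of_ne_zero hn)
  simpa [qAt_zero] using this

theorem IsPosDef.qAt_ne_zero (h : IsPosDef s) (hp : ∀ n, ∀ r ∈ nodes s n, p < r) {n : ℕ}
    (hn : n ≠ 0) : qAt s p n ≠ 0 := by
  intro h0
  have := h.ratio_pos hp hn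
  rw [h0] at this
  simp at this

end Ratio

/-! ### Divergence of the ratios and uniqueness on a half-line -/

/-- If `-Q_n(p) / P_n(p) → ∞`, at most one solution lives on `[p, ∞)`. -/
theorem IsPosDef.eq_of_tendsto_ratio_atTop (h : IsPosDef s) (hS : IsSquareSummable s)
    {μ ν : Measure ℝ} {p : ℝ} (hμ : IsHamburgerSolution s μ) (hν : IsHamburgerSolution s ν)
    (hμp : ∀ᵐ x ∂μ, p ≤ x) (hνp : ∀ᵐ x ∂ν, p ≤ x)
    (hr : Tendsto (fun n => -qAt s p n / pAt s p n) atTop atTop) : μ = ν := by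
  have := hμ.isProbabilityMeasure
  have := hν.isProbabilityMeasure
  have hp : ∀ n, ∀ r ∈ nodes s n, p < r := fun n r hr => hμ.lt_of_mem_nodes h hμp hr
  have ht : Tendsto (fun n => pAt s p n / qAt s p n) atTop (𝓝 0) := by
    have := hr.inv_tendsto_atTop.neg
    rw [neg_zero] at this
    refine this.congr fun n => ?_
    rw [Pi.inv_apply, inv_div, div_neg, neg_neg]
  -- The coefficient of the transform is nonzero, so this equation determines the transform at `y`.
  suffices key : ∀ m, IsHamburgerSolution s m → (∀ᵐ x ∂m, p ≤ x) → ∀ y < p,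
      (1 + (y - p) * ∑' k, pAt s p k * qAt s y k) +
        (∫ x, 1 / (x - y) ∂m) * ((y - p) * ∑' k, pAt s p k * pAt s y k) = 0 by
    refine ext_of_stieltjes_eq_of_lt hμp hνp fun y hy => ?_
    have hK : 0 < ∑' k, pAt s p k * pAt s y k :=
      (hS.summable_mul_real p y).1.tsum_pos (fun k => (h.pAt_mul_pAt_pos hp hy.le k).le) 0
        (h.pAt_mul_pAt_pos hp hy.le 0)
    have hD : (y - p) * ∑' k, pAt s p k * pAt s y k ≠ 0 :=
      mul_ne_zero (by linarith) hK.ne'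
    have h1 := key μ hμ hμp y hy
    have h2 := key ν hν hνp y hy
    exact mul_right_cancel₀ hD (by linarith)
  intro m hm hmp y hy
  obtain ⟨s1, s2, s3, s4⟩ := hS.summable_mul_real p y
  have hK : 0 < ∑' k, pAt s p k * pAt s y k :=
    s1.tsum_pos (fun k => (h.pAt_mul_pAt_pos hp hy.le k).le) 0 (h.pAt_mul_pAt_pos hp hy.le 0)
  have t1 := s1.hasSum.tendsto_sum_nat
  have t2 := s2.hasSum.tendsto_sum_nat
  have t3 := s3.hasSum.tendsto_sum_nat
  have t4 := s4.hasSum.tendsto_sum_nat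
  set K := ∑' k, pAt s p k * pAt s y k
  set G := ∑' k, pAt s p k * qAt s y k
  set w := ∫ x, 1 / (x - y) ∂m
  have hq : ∀ᶠ n in atTop, qAt s p n ≠ 0 :=
    (eventually_ne_atTop 0).mono fun n hn => h.qAt_ne_zero hp hn
  have lP : Tendsto (fun n => pAt s y n / qAt s p n) atTop (𝓝 ((y - p) * K)) := by
    have := ht.add ((t1.sub (t2.mul ht)).const_mul (y - p))
    rw [mul_zero, sub_zero, zero_add] at this
    refine this.congr' (hq.mono fun n hn => ?_)
    rw [eq_div_iff hn, h.pAt_variation p y n]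
    field_simp
  have lQ : Tendsto (fun n => qAt s y n / qAt s p n) atTop (𝓝 (1 + (y - p) * G)) := by
    have := ((t3.sub (t4.mul ht)).const_mul (y - p)).const_add 1
    rw [mul_zero, sub_zero] at this
    refine this.congr' (hq.mono fun n hn => ?_)
    rw [eq_div_iff hn, h.qAt_variation p y n]
    field_simp
  -- After division by `Q_n(p)²`, the Gauss bound and the bound `hup` constrain the same quantity in
  -- the limit. Their prefactors `(y - p) * K` and `K` have opposite signs, so it is zero.
  have hlow : 0 ≤ ((y - p) * K) * ((1 + (y - p) * G) + w * ((y - p) * K)) := by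
    refine ge_of_tendsto (lP.mul (lQ.add (lP.const_mul w))) (Eventually.of_forall fun n => ?_)
    have := div_nonneg (hm.orthP_mul_nonneg h hmp hy n) (mul_self_nonneg (qAt s p n))
    refine this.trans_eq ?_
    ring
  have hup : 0 ≤ K * (1 + (y - p) * (G + w * K)) := by
    refine ge_of_tendsto (t1.mul (((t3.add (t1.const_mul w)).const_mul (y - p)).const_add 1))
      ((eventually_ne_atTop 0).mono fun n hn => ?_)
    refine (hm.kernel_mul_nonneg h hmp hy hn).trans_eq ?_
    congr 3
    rw [Finset.mul_sum, ← Finset.sum_add_distrib]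
    exact Finset.sum_congr rfl fun k _ => by ring
  have h1 : 0 ≤ (1 + (y - p) * G) + w * ((y - p) * K) := by
    have := nonneg_of_mul_nonneg_right hup hK
    linarith
  have h2 : (1 + (y - p) * G) + w * ((y - p) * K) ≤ 0 := by
    have hneg : (y - p) * K < 0 := mul_neg_of_neg_of_pos (by linarith) hK
    exact nonpos_of_mul_nonneg_right hlow hneg
  linarith

/-- At a point below which two solutions live, the ratios `P_n(p) / Q_n(p)` have a negative
limit. -/
theorem IsPosDef.exists_tendsto_ratio (h : IsPosDef s) (hS : IsSquareSummable s)
    {μ ν : Measure ℝ} {p : ℝ} (hμ : IsHamburgerSolution s μ) (hν : IsHamburgerSolution s ν)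
    (hμp : ∀ᵐ x ∂μ, p ≤ x) (hνp : ∀ᵐ x ∂ν, p ≤ x) (hne : μ ≠ ν) :
    ∃ α < 0, Tendsto (fun n => pAt s p n / qAt s p n) atTop (𝓝 α) := by
  have hp : ∀ n, ∀ r ∈ nodes s n, p < r := fun n r hr => hμ.lt_of_mem_nodes h hμp hr
  have hmono := h.strictMono_ratio hp
  rcases tendsto_atTop_of_monotone hmono.monotone with htop | ⟨l, hl⟩
  · exact absurd (h.eq_of_tendsto_ratio_atTop hS hμ hν hμp hνp htop) hne
  · have hl0 : 0 < l := (h.ratio_pos hp one_ne_zero).trans_le (hmono.monotone.ge_of_tendsto hl 1)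
    refine ⟨-l⁻¹, by simpa using hl0, ((hl.inv₀ hl0.ne').neg).congr fun n => ?_⟩
    rw [inv_div, div_neg, neg_neg]

/-- At the limit `ξ` of the smallest zeros, `-Q_n(ξ) / P_n(ξ) → ∞`. -/
theorem IsPosDef.tendsto_ratio_atTop (h : IsPosDef s) (hS : IsSquareSummable s) {ξ : ℝ}
    (hξ : Tendsto (smallestZero s) atTop (𝓝 ξ)) (hp : ∀ n, ∀ r ∈ nodes s n, ξ < r) :
    Tendsto (fun n => -qAt s ξ n / pAt s ξ n) atTop atTop := by
  have hmono := (h.strictMono_ratio hp).monotone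
  refine (tendsto_atTop_of_monotone hmono).resolve_right ?_
  rintro ⟨l, hl⟩
  -- The radius `|ξ| + 1` contains `ξ` and all smallest zeros within distance `1` of it.
  obtain ⟨d, hd, hdb⟩ := hS.exists_dominating_real (|ξ| + 1)
  have hd0 : ∀ k, 0 ≤ d k := fun k =>
    (norm_nonneg _).trans (hdb ξ ξ (by linarith) (by linarith) k).1
  have hT : ∀ (f : ℕ → ℝ) n, (∀ k, ‖f k‖ ≤ d k) → |∑ k ∈ Finset.range n, f k| ≤ ∑' k, d k :=
    fun f n hf => (norm_sum_le_of_le _ fun k _ => hf k).trans (hd.sum_le_tsum _ fun k _ => hd0 k)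
  set T := ∑' k, d k
  have hlim : Tendsto (fun n => |smallestZero s n - ξ| * (T * l + T)) atTop (𝓝 0) := by
    have := ((hξ.sub_const ξ).abs).mul_const (T * l + T)
    simpa using this
  have hnear : ∀ᶠ n in atTop, |smallestZero s n - ξ| < 1 := by
    have := (hξ.sub_const ξ).abs
    rw [sub_self, abs_zero] at this
    exact this.eventually (gt_mem_nhds one_pos)
  obtain ⟨n, ⟨hn1, hn2⟩, hn0⟩ := ((hlim.eventually (gt_mem_nhds one_pos)).and hnear).and
    (eventually_ne_atTop 0) |>.exists
  set m := smallestZero s n with hm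
  have hm0 : pAt s m n = 0 := by rw [pAt_real]; exact h.mem_nodes.1 (h.smallestZero_mem hn0)
  have hmR : |m| ≤ |ξ| + 1 := by
    have := abs_sub_abs_le_abs_sub m ξ
    linarith
  have hb := hdb ξ m (by linarith) hmR
  have h1 := hT (fun k => pAt s ξ k * pAt s m k) n fun k => (hb k).1
  have h2 := hT (fun k => qAt s ξ k * pAt s m k) n fun k => (hb k).2.1
  have hv := h.pAt_variation ξ m n
  rw [hm0] at hv
  have hP := h.pAt_ne_zero hp n
  have hρ := h.ratio_pos hp hn0
  have hρl : -qAt s ξ n / pAt s ξ n ≤ l := hmono.ge_of_tendsto hl n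
  set ρ := -qAt s ξ n / pAt s ξ n with hρd
  have hq : qAt s ξ n = -ρ * pAt s ξ n := by rw [hρd]; field_simp
  rw [hq] at hv
  -- This is the variation formula at `P_n(m) = 0`, divided by `P_n(ξ)`. With ratios bounded by `l`,
  -- the left side is at most `|m - ξ| * (T * l + T) < 1`.
  have e : (m - ξ) * ((∑ k ∈ Finset.range n, pAt s ξ k * pAt s m k) * ρ +
      ∑ k ∈ Finset.range n, qAt s ξ k * pAt s m k) = 1 := by
    refine mul_right_cancel₀ hP ?_
    linear_combination hv
  have hT0 : 0 ≤ T := (abs_nonneg _).trans h1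
  have : |(m - ξ) * ((∑ k ∈ Finset.range n, pAt s ξ k * pAt s m k) * ρ +
      ∑ k ∈ Finset.range n, qAt s ξ k * pAt s m k)| ≤ |m - ξ| * (T * l + T) := by
    rw [abs_mul]
    refine mul_le_mul_of_nonneg_left ((abs_add_le _ _).trans (add_le_add ?_ h2)) (abs_nonneg _)
    rw [abs_mul, abs_of_pos hρ]
    exact mul_le_mul h1 hρl hρ.le hT0
  rw [e, abs_one] at this
  linarith

/-! ### Weak limits and moments -/

/-- Truncation of a real number to `[-R, R]`. -/
def truncate (R x : ℝ) : ℝ := max (-R) (min x R)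

theorem continuous_truncate (R : ℝ) : Continuous (truncate R) :=
  continuous_const.max (continuous_id.min continuous_const)

theorem abs_truncate_le {R : ℝ} (hR : 0 ≤ R) (x : ℝ) : |truncate R x| ≤ R :=
  abs_le.2 ⟨le_max_left _ _, max_le (by linarith) (min_le_right _ _)⟩

theorem truncate_of_abs_le {R x : ℝ} (hx : |x| ≤ R) : truncate R x = x := by
  obtain ⟨h1, h2⟩ := abs_le.1 hx
  rw [truncate, min_eq_left h2, max_eq_right h1]

theorem abs_truncate_le_abs {R : ℝ} (hR : 0 ≤ R) (x : ℝ) : |truncate R x| ≤ |x| := by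
  rcases le_total |x| R with h | h
  · rw [truncate_of_abs_le h]
  · exact (abs_truncate_le hR x).trans h

/-- Powers of the truncation as bounded continuous functions. -/
def truncatePow {R : ℝ} (hR : 0 ≤ R) (k : ℕ) : ℝ →ᵇ ℝ :=
  BoundedContinuousFunction.ofNormedAddCommGroup (fun x => truncate R x ^ k)
    ((continuous_truncate R).pow k) (R ^ k) fun x => by
      rw [norm_pow]
      exact pow_le_pow_left₀ (norm_nonneg _) (abs_truncate_le hR x) k

theorem truncatePow_apply {R : ℝ} (hR : 0 ≤ R) (k : ℕ) (x : ℝ) :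
    truncatePow hR k x = truncate R x ^ k := rfl

/-- A higher even power controls the truncation error at rate `1 / R`, uniformly over measures with
that moment bounded. -/
theorem abs_truncate_pow_sub_le {R : ℝ} (hR : 0 < R) (k : ℕ) (x : ℝ) :
    |truncate R x ^ k - x ^ k| ≤ 2 / R * (1 + x ^ (2 * (k + 1))) := by
  have hnn : 0 ≤ x ^ (2 * (k + 1)) := by rw [pow_mul]; positivity
  rcases le_total |x| R with h | h
  · rw [truncate_of_abs_le h, sub_self, abs_zero]
    positivity
  · have h1 : |truncate R x ^ k| ≤ |x| ^ k := by
      rw [abs_pow]; exact pow_le_pow_left₀ (abs_nonneg _) (abs_truncate_le_abs hR.le x) k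
    have h2 : |truncate R x ^ k - x ^ k| ≤ 2 * |x| ^ k := by
      refine (abs_sub _ _).trans ?_
      rw [abs_pow x k]
      linarith
    have h3 : R * |x| ^ k ≤ 1 + x ^ (2 * (k + 1)) := by
      calc R * |x| ^ k ≤ |x| * |x| ^ k := mul_le_mul_of_nonneg_right h (by positivity)
        _ = |x| ^ (k + 1) := by rw [pow_succ]; ring
        _ ≤ 1 + (|x| ^ (k + 1)) ^ 2 := by nlinarith [sq_nonneg (|x| ^ (k + 1) - 1)]
        _ = 1 + x ^ (2 * (k + 1)) := by
          rw [← pow_mul, mul_comm (k + 1) 2, pow_mul, sq_abs, ← pow_mul]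
    rw [div_mul_eq_mul_div, le_div_iff₀ hR]
    nlinarith

theorem abs_integral_truncatePow_sub_le {m : Measure ℝ} [IsProbabilityMeasure m]
    (hm : ∀ k : ℕ, Integrable (fun x : ℝ => x ^ k) m) {R : ℝ} (hR : 0 < R) (k : ℕ) :
    |∫ x, truncatePow hR.le k x ∂m - ∫ x, x ^ k ∂m| ≤
      2 / R * (1 + ∫ x, x ^ (2 * (k + 1)) ∂m) := by
  rw [← integral_sub ((truncatePow hR.le k).integrable m) (hm k)]
  have hi : Integrable (fun x : ℝ => 1 + x ^ (2 * (k + 1))) m := (integrable_const 1).add (hm _)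
  refine (norm_integral_le_of_norm_le (f := fun x => truncatePow hR.le k x - x ^ k)
    (hi.const_mul (2 / R)) (Eventually.of_forall fun x => abs_truncate_pow_sub_le hR k x)).trans_eq ?_
  rw [integral_const_mul, integral_add (integrable_const 1) (hm _)]
  simp

/-- A weak limit of measures whose moments eventually agree with `s` solves the moment problem. -/
theorem isHamburgerSolution_of_tendsto {m : ℕ → ProbabilityMeasure ℝ} {F : ProbabilityMeasure ℝ}
    (hlim : Tendsto m atTop (𝓝 F))
    (hint : ∀ n (k : ℕ), Integrable (fun x : ℝ => x ^ k) (m n : Measure ℝ))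
    (hmom : ∀ k : ℕ, ∀ᶠ n in atTop, ∫ x, x ^ k ∂(m n : Measure ℝ) = s k) :
    IsHamburgerSolution s (F : Measure ℝ) := by
  rw [ProbabilityMeasure.tendsto_iff_forall_integral_tendsto] at hlim
  have heven : ∀ k : ℕ, Integrable (fun x : ℝ => x ^ (2 * k)) (F : Measure ℝ) := by
    intro k
    have hpos : ∀ R x : ℝ, 0 ≤ truncate R x ^ (2 * k) := fun R x => by
      rw [pow_mul]; positivity
    have hle : ∀ R : ℝ, (hR : 0 ≤ R) → ∫ x, truncatePow hR (2 * k) x ∂(F : Measure ℝ) ≤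
        s (2 * k) := by
      intro R hR
      refine le_of_tendsto (hlim (truncatePow hR (2 * k))) ((hmom (2 * k)).mono fun n hn => ?_)
      rw [← hn]
      refine integral_mono ((truncatePow hR _).integrable _) (hint n _) fun x => ?_
      simp only [truncatePow_apply]
      rw [pow_mul, pow_mul, ← sq_abs, ← sq_abs x]
      exact pow_le_pow_left₀ (sq_nonneg _)
        (pow_le_pow_left₀ (abs_nonneg _) (abs_truncate_le_abs hR x) 2) k
    -- Fatou: the truncated even moments are bounded by `s (2 * k)` uniformly in the truncation
    -- level.
    refine integrable_of_tendsto (G := fun n x => truncate (n : ℝ) x ^ (2 * k))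
      (Eventually.of_forall fun x => ?_)
      (fun n => ((continuous_truncate _).pow _).aestronglyMeasurable) ?_
    · refine tendsto_const_nhds.congr' ?_
      filter_upwards [eventually_ge_atTop ⌈|x|⌉₊] with n hn
      rw [truncate_of_abs_le ((Nat.le_ceil _).trans (by exact_mod_cast hn))]
    · refine ne_top_of_le_ne_top (ENNReal.ofReal_ne_top (r := s (2 * k))) ?_
      refine liminf_le_of_frequently_le' (Frequently.of_forall fun n => ?_)
      have hi := (truncatePow n.cast_nonneg (2 * k)).integrable (F : Measure ℝ)
      refine (ofReal_integral_norm_eq_lintegral_enorm hi).symm.trans_le ?_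
      refine ENNReal.ofReal_le_ofReal (le_trans (le_of_eq ?_) (hle n n.cast_nonneg))
      exact integral_congr_ae (Eventually.of_forall fun x => Real.norm_of_nonneg (hpos _ _))
  have hall : ∀ k : ℕ, Integrable (fun x : ℝ => x ^ k) (F : Measure ℝ) := by
    intro k
    refine ((integrable_const (1 : ℝ)).add (heven k)).mono'
      (continuous_pow k).aestronglyMeasurable (Eventually.of_forall fun x => ?_)
    rw [norm_pow, Real.norm_eq_abs, Pi.add_apply, pow_mul, ← sq_abs, ← pow_mul, mul_comm 2 k,
      pow_mul]
    nlinarith [sq_nonneg (|x| ^ k - 1)]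
  refine ⟨inferInstance, hall, fun k => ?_⟩
  -- The two summands bound the truncation errors of the approximating measures and of the limit.
  set c := (1 + s (2 * (k + 1))) + (1 + ∫ x, x ^ (2 * (k + 1)) ∂(F : Measure ℝ)) with hc
  have hbound : ∀ R : ℝ, 0 < R → |∫ x, x ^ k ∂(F : Measure ℝ) - s k| ≤ 2 / R * c := by
    intro R hR
    have h1 := abs_integral_truncatePow_sub_le hall hR k
    have h2 : |∫ x, truncatePow hR.le k x ∂(F : Measure ℝ) - s k| ≤
        2 / R * (1 + s (2 * (k + 1))) := by
      refine le_of_tendsto ((hlim (truncatePow hR.le k)).sub_const (s k)).abs ?_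
      filter_upwards [hmom k, hmom (2 * (k + 1))] with n hn1 hn2
      have := abs_integral_truncatePow_sub_le (hint n) hR k
      rwa [hn1, hn2] at this
    have h3 := abs_sub_le (∫ x, x ^ k ∂(F : Measure ℝ))
      (∫ x, truncatePow hR.le k x ∂(F : Measure ℝ)) (s k)
    rw [abs_sub_comm _ (∫ x, truncatePow hR.le k x ∂(F : Measure ℝ))] at h3
    rw [hc]
    linarith
  have hlim0 : Tendsto (fun R : ℝ => 2 / R * c) atTop (𝓝 0) := by
    simpa using (tendsto_const_nhds.div_atTop tendsto_id : Tendsto (fun R : ℝ => 2 / R) atTop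
      (𝓝 0)).mul_const c
  have h0 := ge_of_tendsto hlim0 ((eventually_gt_atTop 0).mono hbound)
  exact sub_eq_zero.1 (abs_nonpos_iff.1 h0)

/-- Probability measures with uniformly bounded second moments have a weakly convergent
subsequence. -/
theorem exists_subseq_tendsto_of_integral_sq_le (m : ℕ → ProbabilityMeasure ℝ) {c : ℝ}
    (hint : ∀ n, Integrable (fun x : ℝ => x ^ 2) (m n : Measure ℝ))
    (hc : ∀ n, ∫ x, x ^ 2 ∂(m n : Measure ℝ) ≤ c) :
    ∃ (F : ProbabilityMeasure ℝ) (φ : ℕ → ℕ), StrictMono φ ∧ Tendsto (m ∘ φ) atTop (𝓝 F) := by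
  have htight : IsTightMeasureSet
      {((μ : ProbabilityMeasure ℝ) : Measure ℝ) | μ ∈ Set.range m} := by
    refine isTightMeasureSet_of_tendsto_measure_norm_gt ?_
    have hlim : Tendsto (fun r : ℝ => ENNReal.ofReal (c / r ^ 2)) atTop (𝓝 0) := by
      have h1 : Tendsto (fun r : ℝ => c / r ^ 2) atTop (𝓝 0) :=
        tendsto_const_nhds.div_atTop (tendsto_pow_atTop two_ne_zero)
      simpa using ENNReal.tendsto_ofReal h1
    refine tendsto_of_tendsto_of_tendsto_of_le_of_le' tendsto_const_nhds hlim
      (Eventually.of_forall fun _ => zero_le) ((eventually_gt_atTop 0).mono fun r hr => ?_)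
    refine iSup₂_le ?_
    rintro _ ⟨_, ⟨n, rfl⟩, rfl⟩
    have h1 := (mul_meas_ge_le_integral_of_nonneg (Eventually.of_forall fun x => sq_nonneg x)
      (hint n) (r ^ 2)).trans (hc n)
    have h2 : (m n : Measure ℝ).real {x | r ^ 2 ≤ x ^ 2} ≤ c / r ^ 2 := by
      rw [le_div_iff₀ (by positivity), mul_comm]; exact h1
    refine (measure_mono (fun x (hx : r < ‖x‖) => ?_ :
      {x : ℝ | r < ‖x‖} ⊆ {x | r ^ 2 ≤ x ^ 2})).trans ?_
    · rw [Set.mem_ofPred_eq, ← sq_abs x]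
      exact pow_le_pow_left₀ hr.le hx.le 2
    · rw [← ENNReal.ofReal_toReal (measure_ne_top (m n : Measure ℝ) {x | r ^ 2 ≤ x ^ 2})]
      exact ENNReal.ofReal_le_ofReal h2
  obtain ⟨F, -, φ, hφ, hF⟩ := (isCompact_closure_of_isTightMeasureSet htight).isSeqCompact
    fun n => subset_closure ⟨n, rfl⟩
  exact ⟨F, φ, hφ, hF⟩

/-! ### The limit of the Gauss quadratures -/

theorem norm_integral_resolvent_le (m : Measure ℝ) [IsProbabilityMeasure m] {z : ℂ}
    (hz : z.im ≠ 0) : ‖∫ x : ℝ, 1 / ((x : ℂ) - z) ∂m‖ ≤ 1 / |z.im| := by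
  refine (norm_integral_le_of_norm_le_const (C := 1 / |z.im|)
    (Eventually.of_forall fun x => ?_)).trans (by simp)
  rw [norm_div, norm_one]
  refine one_div_le_one_div_of_le (abs_pos.2 hz) ?_
  simpa using Complex.abs_im_le_norm ((x : ℂ) - z)

/-- `P_n` vanishes at every node, so its integral against the resolvent is zero and the Gauss
transform is `-Q_n / P_n` where `P_n(z) ≠ 0`. -/
theorem IsPosDef.qAt_add_gauss_mul_pAt (h : IsPosDef s) (n : ℕ) {z : ℂ} (hz : z.im ≠ 0) :
    qAt s z n + (∫ x : ℝ, 1 / ((x : ℂ) - z) ∂(gaussMeasure s n)) * pAt s z n = 0 := by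
  have key := h.integral_orthP_div (𝕜 := ℂ) (m := gaussMeasure s n) (z := z)
    (Eventually.of_forall fun x h0 => hz ?_) (fun k => integrable_gaussMeasure s n _)
    (fun k => integrable_gaussMeasure s n _) (N := n) (fun k hk => ?_) n le_rfl
  · refine Eq.trans (Eq.symm key) (integral_eq_zero_of_ae ?_)
    filter_upwards [ae_mem_nodes_gaussMeasure s n] with x hx
    rw [h.mem_nodes.1 hx]
    simp
  · rw [← sub_eq_zero.1 h0]
    exact Complex.ofReal_im x
  · rw [h.integral_eval_gaussMeasure, h.momentFunctional_orthP]
    rw [h.orthP_degree]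
    exact_mod_cast (by omega : k < 2 * n)

/-- The Stieltjes transforms of the Gauss quadratures converge, and the limit is given by the
Nevanlinna functions. -/
theorem IsPosDef.tendsto_gauss_stieltjes (h : IsPosDef s) (hS : IsSquareSummable s) {α : ℝ}
    (hα : Tendsto (fun n => pAt s (0 : ℝ) n / qAt s (0 : ℝ) n) atTop (𝓝 α))
    (hq0 : ∀ n, n ≠ 0 → qAt s (0 : ℝ) n ≠ 0) {z : ℂ} (hz : z.im ≠ 0) :
    Tendsto (fun n => ∫ x : ℝ, 1 / ((x : ℂ) - z) ∂(gaussMeasure s n)) atTop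
      (𝓝 (-((nevA s z * (α : ℂ) - nevC s z) / (nevB s z * (α : ℂ) - nevD s z)))) := by
  have hreal : ∀ p : ℝ[X], aeval (0 : ℂ) p = ((aeval (0 : ℝ) p : ℝ) : ℂ) := fun p => by
    rw [← aeval_ofReal_eq, Complex.ofReal_zero]
  have ht : Tendsto (fun n => pAt s (0 : ℂ) n / qAt s (0 : ℂ) n) atTop (𝓝 (α : ℂ)) := by
    refine ((Complex.continuous_ofReal.tendsto α).comp hα).congr fun n => ?_
    simp [pAt, qAt, hreal]
  have hq : ∀ᶠ n in atTop, qAt s (0 : ℂ) n ≠ 0 := by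
    filter_upwards [eventually_ne_atTop 0] with n hn
    rw [qAt, hreal]
    exact Complex.ofReal_ne_zero.2 (hq0 n hn)
  obtain ⟨s1, s2, s3, s4⟩ := hS.summable_mul 0 z
  have t1 := s1.hasSum.tendsto_sum_nat
  have t2 := s2.hasSum.tendsto_sum_nat
  have t3 := s3.hasSum.tendsto_sum_nat
  have t4 := s4.hasSum.tendsto_sum_nat
  have eA : nevA s z = (z - 0) * ∑' k, qAt s (0 : ℂ) k * qAt s z k := by
    simp only [nevA, nevA₂, qAt, mul_comm]
  have eB : nevB s z = -1 + (z - 0) * ∑' k, qAt s (0 : ℂ) k * pAt s z k := by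
    simp only [nevB, nevB₂, qAt, pAt, mul_comm]
  have eC : nevC s z = 1 + (z - 0) * ∑' k, pAt s (0 : ℂ) k * qAt s z k := by
    simp only [nevC, nevC₂, qAt, pAt, mul_comm]
  have eD : nevD s z = (z - 0) * ∑' k, pAt s (0 : ℂ) k * pAt s z k := by
    simp only [nevD, nevD₂, pAt, mul_comm]
  have hdet : nevA s z * nevD s z - nevB s z * nevC s z = 1 := by
    have l := ((((t2.const_mul (z - 0)).const_sub 1).mul ((t3.const_mul (z - 0)).const_add 1)).add
      ((t4.const_mul (z - 0)).mul (t1.const_mul (z - 0)))).comp (tendsto_add_atTop_nat 1)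
    have := tendsto_nhds_unique (l.congr fun n => h.truncated_det 0 z n) tendsto_const_nhds
    rw [eA, eB, eC, eD]
    linear_combination this
  have lP : Tendsto (fun n => pAt s z n / qAt s (0 : ℂ) n) atTop
      (𝓝 (nevD s z - nevB s z * α)) := by
    have l := ht.add ((t1.sub (t2.mul ht)).const_mul (z - 0))
    have e : (α : ℂ) + (z - 0) * ((∑' k, pAt s (0 : ℂ) k * pAt s z k) -
        (∑' k, qAt s (0 : ℂ) k * pAt s z k) * α) = nevD s z - nevB s z * α := by
      rw [eB, eD]; ring
    rw [e] at l
    refine l.congr' (hq.mono fun n hn => ?_)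
    rw [eq_div_iff hn, h.pAt_variation 0 z n]
    field_simp
  have lQ : Tendsto (fun n => qAt s z n / qAt s (0 : ℂ) n) atTop
      (𝓝 (nevC s z - nevA s z * α)) := by
    have l := ((t3.sub (t4.mul ht)).const_mul (z - 0)).const_add 1
    have e : 1 + (z - 0) * ((∑' k, pAt s (0 : ℂ) k * qAt s z k) -
        (∑' k, qAt s (0 : ℂ) k * qAt s z k) * α) = nevC s z - nevA s z * α := by
      rw [eA, eC]; ring
    rw [e] at l
    refine l.congr' (hq.mono fun n hn => ?_)
    rw [eq_div_iff hn, h.qAt_variation 0 z n]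
    field_simp
  -- The uniform bound on Gauss transforms survives in the limit. A zero denominator would force a
  -- zero numerator, against determinant one.
  have hbound : ‖nevC s z - nevA s z * α‖ ≤ 1 / |z.im| * ‖nevD s z - nevB s z * α‖ := by
    refine le_of_tendsto_of_tendsto lQ.norm (lP.norm.const_mul (1 / |z.im|)) ?_
    filter_upwards [eventually_ne_atTop 0] with n hn
    have := h.isProbabilityMeasure_gaussMeasure hn
    have h1 := eq_neg_of_add_eq_zero_left (h.qAt_add_gauss_mul_pAt n hz)
    rw [norm_div, norm_div, h1, norm_neg, norm_mul, mul_div_assoc]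
    exact mul_le_mul_of_nonneg_right (norm_integral_resolvent_le _ hz) (by positivity)
  have hD : nevD s z - nevB s z * α ≠ 0 := by
    intro h0
    rw [h0, norm_zero, mul_zero, norm_le_zero_iff] at hbound
    have : (1 : ℂ) = 0 := by
      rw [← hdet]
      linear_combination nevA s z * h0 - nevB s z * hbound
    exact one_ne_zero this
  have hlim := (lQ.div lP hD).neg
  have e : -((nevC s z - nevA s z * α) / (nevD s z - nevB s z * α)) =
      -((nevA s z * (α : ℂ) - nevC s z) / (nevB s z * (α : ℂ) - nevD s z)) := by
    rw [← neg_sub, ← neg_sub (nevB s z * (α : ℂ)), neg_div_neg_eq]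
  rw [e] at hlim
  refine hlim.congr' ?_
  filter_upwards [hq, lP.eventually_ne hD] with n hn1 hn2
  have hPz : pAt s z n ≠ 0 := fun h0 => hn2 (by rw [h0, zero_div])
  have h1 := h.qAt_add_gauss_mul_pAt n hz
  rw [Pi.div_apply, div_div_div_cancel_right₀ hn1, ← neg_div, div_eq_iff hPz]
  linear_combination -h1

/-- A weak limit of the Gauss quadratures is an N-extremal solution supported to the right of the
limit of the smallest zeros. -/
theorem IsPosDef.exists_isNExtremal (h : IsPosDef s) (hS : IsSquareSummable s) {α ξ : ℝ}
    (hα : Tendsto (fun n => pAt s (0 : ℝ) n / qAt s (0 : ℝ) n) atTop (𝓝 α))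
    (hq0 : ∀ n, n ≠ 0 → qAt s (0 : ℝ) n ≠ 0) (hξ : ∀ n, ∀ r ∈ nodes s n, ξ ≤ r) :
    ∃ F : Measure ℝ, IsNExtremal s α F ∧ ∀ᵐ x ∂F, ξ ≤ x := by
  have hpow : ∀ n k : ℕ, k < 2 * n → ∫ x, x ^ k ∂(gaussMeasure s n) = s k := by
    intro n k hk
    have := h.integral_eval_gaussMeasure (n := n) (p := X ^ k) (by
      rw [degree_X_pow]; exact_mod_cast hk)
    rw [momentFunctional_X_pow] at this
    simpa using this
  -- From two nodes on, the second moment is exactly `s 2`, which gives tightness.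
  let m : ℕ → ProbabilityMeasure ℝ := fun n =>
    ⟨gaussMeasure s (n + 2), h.isProbabilityMeasure_gaussMeasure (by omega)⟩
  obtain ⟨F, φ, hφ, hF⟩ := exists_subseq_tendsto_of_integral_sq_le m (c := s 2)
    (fun n => integrable_gaussMeasure s _ _) (fun n => (hpow (n + 2) 2 (by omega)).le)
  have hφ' : Tendsto (fun n => φ n + 2) atTop atTop :=
    (tendsto_add_atTop_nat 2).comp hφ.tendsto_atTop
  refine ⟨F, ⟨isHamburgerSolution_of_tendsto hF (fun n k => integrable_gaussMeasure s _ _)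
    fun k => ?_, fun z hz => ?_⟩, ?_⟩
  · filter_upwards [hφ'.eventually_gt_atTop k] with n hn
    exact hpow (φ n + 2) k (by omega)
  · have hd : ∀ x : ℝ, |z.im| ≤ ‖((id x : ℝ) : ℂ) - z‖ := fun x => by
      simpa using Complex.abs_im_le_norm ((x : ℂ) - z)
    have h1 := (ProbabilityMeasure.tendsto_iff_forall_integral_rclike_tendsto ℂ).1 hF
      (resolventBCF id continuous_id z (abs_pos.2 hz) hd)
    have h2 := (h.tendsto_gauss_stieltjes hS hα hq0 hz).comp hφ'
    exact tendsto_nhds_unique h1 h2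
  -- Portmanteau on the open half-line `(-∞, ξ)`, which contains no node.
  · have h1 := ProbabilityMeasure.le_liminf_measure_open_of_tendsto hF (isOpen_Iio (a := ξ))
    have h2 : ∀ n, ((m ∘ φ) n : Measure ℝ) (Set.Iio ξ) = 0 := by
      intro n
      have : ∀ᵐ x ∂(gaussMeasure s (φ n + 2)), ¬ x ∈ Set.Iio ξ :=
        (ae_mem_nodes_gaussMeasure s _).mono fun x hx => not_lt.2 (hξ _ x hx)
      simp only [ae_iff, not_not] at this
      exact this
    simp only [h2, liminf_const, nonpos_iff_eq_zero] at h1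
    simp only [ae_iff, not_le]
    exact h1

end MomentProblem

end

/-! ### The Friedrichs solution -/

theorem mainTheorem1 (s : ℕ → ℝ) (hs : IsIndetStieltjes s) :
    ∃ (α ξ₁ : ℝ) (F : Measure ℝ),
      -- `α = α(s)` exists and is negative, `ξ₁` exists, and `F` is the unique Friedrichs solution
      IsAlpha s α ∧ α < 0 ∧ IsXiOne s ξ₁ ∧
      IsNExtremal s α F ∧ (∀ F' : Measure ℝ, IsNExtremal s α F' → F' = F) ∧
      infSupport F = (ξ₁ : EReal) ∧
      ∀ ν : Measure ℝ, IsHamburgerSolution s ν → ν ≠ F → infSupport ν < infSupport F := by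
  obtain ⟨μ₁, μ₂, ⟨hμ₁, hsupp₁⟩, ⟨hμ₂, hsupp₂⟩, hne⟩ := hs
  rw [← ae_le_iff_support_subset] at hsupp₁ hsupp₂
  have h := hμ₁.isPosDef_of_ne hμ₂ hne
  have hS := h.isSquareSummable_of_ne hμ₁ hμ₂ hsupp₁ hsupp₂ hne
  have hnodes : ∀ n, ∀ r ∈ nodes s n, 0 < r := fun n r hr => hμ₁.lt_of_mem_nodes h hsupp₁ hr
  obtain ⟨α, hα0, hα⟩ := h.exists_tendsto_ratio hS hμ₁ hμ₂ hsupp₁ hsupp₂ hne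
  obtain ⟨ξ, hξ, hξle⟩ := h.exists_tendsto_smallestZero fun n r hr => (hnodes n r hr).le
  obtain ⟨F, hF, hFξ⟩ := h.exists_isNExtremal hS hα (fun n hn => h.qAt_ne_zero hnodes hn) hξle
  -- Since `F` lives on `[ξ, ∞)`, the inequality `ξ ≤ r` for zeros becomes strict, as the ratios at
  -- `ξ` require.
  have hratio := h.tendsto_ratio_atTop hS hξ fun n r hr => hF.1.lt_of_mem_nodes h hFξ hr
  have hinf : infSupport F = (ξ : EReal) := by
    refine le_antisymm ?_ (coe_le_infSupport_iff.2 hFξ)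
    by_contra! hlt
    -- If `F` lived on `[c, ∞)` with `c > ξ`, all zeros, and so their limit `ξ`, would be at least
    -- `c`.
    obtain ⟨c, hc1, hc2⟩ := EReal.lt_iff_exists_real_btwn.1 hlt
    have hFc := coe_le_infSupport_iff.1 hc2.le
    have hcξ : c ≤ ξ := by
      refine ge_of_tendsto hξ ((eventually_ne_atTop 0).mono fun n hn => ?_)
      exact (hF.1.lt_of_mem_nodes h hFc (h.smallestZero_mem hn)).le
    exact (EReal.coe_lt_coe_iff.1 hc1).not_ge hcξ
  refine ⟨α, ξ, F, ?_, hα0, hξ, hF, fun F' hF' => ?_, hinf, fun ν hν hνF => ?_⟩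
  · simpa only [IsAlpha, pAt_real, qAt_real] using hα
  · have := hF.1.isProbabilityMeasure
    have := hF'.1.isProbabilityMeasure
    exact ext_of_stieltjes_eq fun z hz => by rw [hF'.2 z hz, hF.2 z hz]
  · by_contra! hge
    rw [hinf] at hge
    -- A solution `ν` with infimum at least `ξ` shares `[ξ, ∞)` with `F`, where the divergent ratios
    -- allow only one solution.
    exact hνF (h.eq_of_tendsto_ratio_atTop hS hν hF.1 (coe_le_infSupport_iff.1 hge) hFξ hratio)
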